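/- Let $k,m\ge 0$ be integers, let $(\Omega,\mathcal F,\mathbb P)$ be a probability space and let $U\subset\mathbb R^m$ be a nonempty compact set. Assume the following. (A.1) $W=(W_t)_{t\in\mathbb N}$ is a sequence of i.i.d. random vectors in $\mathbb R^{k+m}$. (A.2) $G\colon\mathbb R^k\times\mathbb R^{k+m}\to\mathbb R^k$ is Borel measurable, and $x\mapsto G(x,w)$ is continuous for every $w$. (The factor process is $X_{t+1}=G(X_t,W_t)$.) (A.3) $F\colon\mathbb R^k\times U\times\mathbb R^{k+m}\to\mathbb R$ is Borel measurable, and $(x,h)\mapsto F(x,h,w)$ is continuous for every $w$. (The one-period log-return of the portfolio is $F(X_t,H_t,W_t)$.) (A.4) There are a continuous function $\omega\colon\mathbb R^k\to[0,\infty)$, Borel functions $a_1,a_2\colon\mathbb R^{k+m}\to[0,\infty)$ and constants $b_1\in(0,1)$, $b_2>0$ such that $$\omega(G(x,w))\le a_1(w)+b_1\omega(x),\qquad |F(x,h,w)|\le a_2(w)+b_2\omega(x)$$ for all $x\in\mathbb R^k$, $h\in U$, $w\in\mathbb R^{k+m}$, and such that $\mu^\gamma(a_1(W_0))$ and $\mu^\gamma(a_2(W_0))$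 are finite for all $\gamma\in\mathbb R$, where $\mu^\gamma(Z)=\frac1\gamma\ln\mathbb E[e^{\gamma Z}]$ for $\gamma\ne0$ and $\mu^0(Z)=\mathbb E[Z]$. (A.5) For every $R>0$ there are a constant $c>0$ and a probability measure $\nu$ on $\mathbb R^k$ such that $\mathbb P[G(x,W_0)\in A]\ge c\,\nu(A)$ for all Borel sets $A\subset\mathbb R^k$ and all $x$ with $\omega(x)\le R$. Let $\mathcal C_\omega(\mathbb R^k)$ be the set of continuous functions $f\colon\mathbb R^k\to\mathbb R$ with $\sup_x\frac{|f(x)|}{1+\omega(x)}<\infty$. For $\gamma<0$, a solution of the Bellman equation with parameter $\gamma$ is a pair $(u,\lambda)\in\mathcal C_\omega(\mathbb R^k)\times\mathbb R$ such that for all $x\in\mathbb R^k$ $$u(x)+\lambda\gamma=\inf_{h\in U}\ln\mathbb E\big[e^{\gamma F(x,h,W_0)+u(G(x,W_0))}\big].$$ Then there is $\gamma_0<0$ such that for every $\gamma\in(\gamma_0,0)$ there is a solution $(u_\gamma,\lambda_\gamma)$ of the Bellman equation with parameter $\gamma$, where $\lambda_\gamma$ is unique and $u_\gamma$ is unique up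 to an additive constant. Moreover, for every $\gamma_0<0$ such that the Bellman equation has a solution $(u_\gamma,\lambda_\gamma)$ for each $\gamma\in(\gamma_0,0)$, the map $\gamma\mapsto\lambda_\gamma$ is continuous on $(\gamma_0,0)$, and for all fixed $a,x\in\mathbb R^k$ the map $\gamma\mapsto\bar u_\gamma(x)=u_\gamma(x)-u_\gamma(a)$ is continuous on $(\gamma_0,0)$. -/

import Mathlib

open MeasureTheory ProbabilityTheory Set

/-- The Euclidean space of column vectors with `n` real coordinates. -/
abbrev Vec (n : ℕ) : Type := EuclideanSpace ℝ (Fin n)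

/-- The entropic utility measure `μ^γ(X)`, with values in the extended reals: it is
`(1/γ) ln E[exp (γ X)]` for `γ ≠ 0`, and `E[X]` for `γ = 0`. -/
noncomputable def entropicUtility {Ω : Type*} [MeasurableSpace Ω] (P : Measure Ω)
    (γ : ℝ) (X : Ω → ℝ) : EReal :=
  if γ = 0 then
    ((∫⁻ o, ENNReal.ofReal (X o) ∂P : ENNReal) : EReal)
      - ((∫⁻ o, ENNReal.ofReal (-X o) ∂P : ENNReal) : EReal)
  else
    ((γ⁻¹ : ℝ) : EReal) * ENNReal.log (∫⁻ o, ENNReal.ofReal (Real.exp (γ * X o)) ∂P)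

/-- The standing assumptions on the market model. The noise is `W`, the compact set of admissible
controls is `U`, the factor process follows `X (t+1) = G (X t) (W t)`, and the one-period
log-return of the portfolio under the control `h` is `F (X t) h (W t)`. -/
structure MarketAssumptions {Ω : Type*} [MeasurableSpace Ω] (P : Measure Ω) {k m : ℕ}
    (W : ℕ → Ω → Vec (k + m)) (U : Set (Vec m))
    (G : Vec k → Vec (k + m) → Vec k) (F : Vec k → U → Vec (k + m) → ℝ)
    (ω : Vec k → ℝ) (a₁ a₂ : Vec (k + m) → ℝ) (b₁ b₂ : ℝ) : Prop where
  -- the noise is a sequence of i.i.d. random vectors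
  measurable_noise : ∀ t, Measurable (W t)
  indep_noise : iIndepFun W P
  identDistrib_noise : ∀ t, IdentDistrib (W t) (W 0) P P
  -- the set of controls
  nonempty_controls : U.Nonempty
  compact_controls : IsCompact U
  -- the factor dynamics
  measurable_factor : Measurable (fun p : Vec k × Vec (k + m) => G p.1 p.2)
  continuous_factor : ∀ w, Continuous (fun x => G x w)
  -- the one-period log-returns
  measurable_return : Measurable (fun p : Vec k × U × Vec (k + m) => F p.1 p.2.1 p.2.2)
  continuous_return : ∀ w, Continuous (fun p : Vec k × U => F p.1 p.2 w)
  -- the weight function and the growth conditions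
  continuous_weight : Continuous ω
  weight_nonneg : ∀ x, 0 ≤ ω x
  measurable_a₁ : Measurable a₁
  measurable_a₂ : Measurable a₂
  a₁_nonneg : ∀ w, 0 ≤ a₁ w
  a₂_nonneg : ∀ w, 0 ≤ a₂ w
  b₁_mem : b₁ ∈ Ioo (0 : ℝ) 1
  b₂_pos : 0 < b₂
  factor_growth : ∀ x w, ω (G x w) ≤ a₁ w + b₁ * ω x
  return_growth : ∀ x h w, |F x h w| ≤ a₂ w + b₂ * ω x
  entropic_a₁ : ∀ γ : ℝ, ∃ r : ℝ, entropicUtility P γ (fun o => a₁ (W 0 o)) = (r : EReal)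
  entropic_a₂ : ∀ γ : ℝ, ∃ r : ℝ, entropicUtility P γ (fun o => a₂ (W 0 o)) = (r : EReal)
  -- the local minorization condition
  minorization : ∀ R : ℝ, 0 < R → ∃ c : ℝ, 0 < c ∧ ∃ ν : Measure (Vec k),
    IsProbabilityMeasure ν ∧ ∀ x, ω x ≤ R → ∀ A : Set (Vec k), MeasurableSet A →
      c * ν.real A ≤ P.real {o | G x (W 0 o) ∈ A}

/-- The space of continuous functions `f` with `sup_x |f x| / (1 + ω x) < ∞`. -/
def weightedSpace {k : ℕ} (ω : Vec k → ℝ) : Set (Vec k → ℝ) :=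
  {f | Continuous f ∧ BddAbove (range fun x => |f x| / (1 + ω x))}

/-- The Bellman operator `T_γ f (x) = inf_{h ∈ U} ln E[exp (γ F(x, h, W₀) + f (G(x, W₀)))]`. Under
the market assumptions, with `f` in the weighted space, the random variables are integrable and
the infimum is that of a nonempty set that is bounded below. -/
noncomputable def bellmanOperator {Ω : Type*} [MeasurableSpace Ω] (P : Measure Ω) {k m : ℕ}
    (W : ℕ → Ω → Vec (k + m)) (U : Set (Vec m))
    (G : Vec k → Vec (k + m) → Vec k) (F : Vec k → U → Vec (k + m) → ℝ)
    (γ : ℝ) (f : Vec k → ℝ) (x : Vec k) : ℝ :=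
  ⨅ h : U, Real.log (∫ o, Real.exp (γ * F x h (W 0 o) + f (G x (W 0 o))) ∂P)

/-- The pair `(u, l)` solves the Bellman equation `u(x) + l γ = T_γ u (x)`, with `u` in the weighted
space. -/
def IsBellmanSolution {Ω : Type*} [MeasurableSpace Ω] (P : Measure Ω) {k m : ℕ}
    (W : ℕ → Ω → Vec (k + m)) (U : Set (Vec m))
    (G : Vec k → Vec (k + m) → Vec k) (F : Vec k → U → Vec (k + m) → ℝ)
    (ω : Vec k → ℝ) (γ : ℝ) (u : Vec k → ℝ) (l : ℝ) : Prop :=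
  u ∈ weightedSpace ω ∧ ∀ x, u x + l * γ = bellmanOperator P W U G F γ u x

/-!
By the Gibbs variational inequality, `log E[exp A] - log E[exp B]` is at most the mean of `A - B`
under the tilted law with density proportional to `exp A`. A difference `T_γ f - T_γ g` of Bellman
operators is therefore controlled by the means of `f - g` under tilted transition laws. Tilting
preserves the drift condition, because the noise has all exponential moments, and the overlap of the
transition laws from sublevel sets of `ω`. Harris' theorem then makes `T_γ` a contraction for the
oscillation relative to `1 + β ω`, but only on functions of bounded size, and `β` depends on that
size. Hence the Bellman equation cannot be solved by a global fixed point; instead the trivial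
solution at `γ = 0`, where the constants are fixed by `T_0`, is continued to nearby parameters by a
fixed point in a small ball, and the same local continuation around an arbitrary solution gives
continuity in `γ`.
-/

/-- All exponential moments of `X`, of both signs, are finite. Integrability includes
measurability, so that no separate assumption is needed. -/
def HasExpMoments {Ω : Type*} [MeasurableSpace Ω] (P : Measure Ω) (X : Ω → ℝ) : Prop :=
  ∀ t : ℝ, Integrable (fun o => Real.exp (t * X o)) P

namespace HasExpMoments

variable {Ω : Type*} [MeasurableSpace Ω] {P : Measure Ω} {X Y : Ω → ℝ}

theorem aemeasurable (hX : HasExpMoments P X) : AEMeasurable X P :=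
  aemeasurable_of_integrable_exp_mul zero_ne_one (hX 0) (hX 1)

theorem integrable_exp (hX : HasExpMoments P X) : Integrable (fun o => Real.exp (X o)) P := by
  simpa only [one_mul] using hX 1

theorem integrable (hX : HasExpMoments P X) : Integrable X P := by
  simpa only [pow_one] using
    integrable_pow_of_integrable_exp_mul one_ne_zero (hX 1) (hX (-1)) 1

theorem const [IsFiniteMeasure P] (c : ℝ) : HasExpMoments P fun _ => c :=
  fun _ => integrable_const _

theorem const_mul (hX : HasExpMoments P X) (c : ℝ) : HasExpMoments P fun o => c * X o :=
  fun t => by simpa only [mul_assoc] using hX (t * c)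

theorem add (hX : HasExpMoments P X) (hY : HasExpMoments P Y) :
    HasExpMoments P fun o => X o + Y o := fun t => by
  have hmeas : AEMeasurable (fun o => X o + Y o) P := hX.aemeasurable.add hY.aemeasurable
  refine ((hX (2 * t)).add (hY (2 * t))).mono' (hmeas.const_mul t).exp.aestronglyMeasurable
    (.of_forall fun o => ?_)
  have hsq : ∀ s, Real.exp (2 * t * s) = Real.exp (t * s) ^ 2 := fun s => by
    rw [← Real.exp_nat_mul]; ring_nf
  rw [Real.norm_eq_abs, Real.abs_exp, mul_add, Real.exp_add, Pi.add_apply, hsq, hsq]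
  nlinarith [two_mul_le_add_sq (Real.exp (t * X o)) (Real.exp (t * Y o)),
    sq_nonneg (Real.exp (t * X o)), sq_nonneg (Real.exp (t * Y o))]

theorem neg (hX : HasExpMoments P X) : HasExpMoments P fun o => -X o := by
  simpa only [neg_one_mul] using hX.const_mul (-1)

theorem sub (hX : HasExpMoments P X) (hY : HasExpMoments P Y) :
    HasExpMoments P fun o => X o - Y o := by
  simpa only [sub_eq_add_neg] using hX.add hY.neg

theorem of_abs_le (hX : HasExpMoments P X) (hY : AEMeasurable Y P) (h : ∀ o, |Y o| ≤ X o) :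
    HasExpMoments P Y := fun t => by
  refine (hX |t|).mono' (hY.const_mul t).exp.aestronglyMeasurable (.of_forall fun o => ?_)
  rw [Real.norm_eq_abs, Real.abs_exp, Real.exp_le_exp]
  exact (le_abs_self _).trans ((abs_mul t (Y o)).trans_le
    (mul_le_mul_of_nonneg_left (h o) (abs_nonneg t)))

theorem tilted (hX : HasExpMoments P X) (hY : HasExpMoments P Y) :
    HasExpMoments (P.tilted Y) X := fun t => by
  rw [integrable_tilted_iff hY.integrable_exp]
  simpa only [smul_eq_mul, ← Real.exp_add] using (hY.add (hX.const_mul t)).integrable_exp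

end HasExpMoments

/-- The logarithm of the exponential moment of `Y`, the cumulant generating function at `1`. -/
noncomputable def logLaplace {Ω : Type*} [MeasurableSpace Ω] (P : Measure Ω) (Y : Ω → ℝ) : ℝ :=
  Real.log (∫ o, Real.exp (Y o) ∂P)

section LogLaplace

variable {Ω : Type*} [MeasurableSpace Ω] {P : Measure Ω} {X Y : Ω → ℝ}

theorem logLaplace_add_const [NeZero P] (hY : HasExpMoments P Y) (c : ℝ) :
    logLaplace P (fun o => Y o + c) = logLaplace P Y + c := by
  simp only [logLaplace, Real.exp_add, integral_mul_const]
  rw [Real.log_mul (integral_exp_pos hY.integrable_exp).ne' (Real.exp_pos c).ne', Real.log_exp]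

theorem logLaplace_le_add_const [NeZero P] (hX : HasExpMoments P X) (hY : HasExpMoments P Y)
    {c : ℝ} (h : ∀ o, X o ≤ Y o + c) : logLaplace P X ≤ logLaplace P Y + c := by
  rw [logLaplace, logLaplace, ← sub_le_iff_le_add, ← Real.log_exp c,
    ← Real.log_div (integral_exp_pos hX.integrable_exp).ne' (Real.exp_pos c).ne',
    ← integral_div]
  refine Real.log_le_log ?_ ?_
  · rw [integral_div]
    exact div_pos (integral_exp_pos hX.integrable_exp) (Real.exp_pos c)
  · refine integral_mono (hX.integrable_exp.div_const _) hY.integrable_exp fun o => ?_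
    rw [div_le_iff₀ (Real.exp_pos c), ← Real.exp_add, Real.exp_le_exp]
    exact h o

theorem integral_le_logLaplace [IsProbabilityMeasure P] (hX : HasExpMoments P X) :
    ∫ o, X o ∂P ≤ logLaplace P X := by
  rw [logLaplace, Real.le_log_iff_exp_le (integral_exp_pos hX.integrable_exp)]
  exact convexOn_exp.map_integral_le Real.continuous_exp.continuousOn isClosed_univ (by simp)
    hX.integrable hX.integrable_exp

theorem neg_logLaplace_le_logLaplace_neg [IsProbabilityMeasure P] (hX : HasExpMoments P X) :
    -logLaplace P X ≤ logLaplace P fun o => -X o := by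
  have hneg := integral_le_logLaplace hX.neg
  rw [integral_neg] at hneg
  linarith [integral_le_logLaplace hX]

/-- The Gibbs variational inequality, which is Jensen's inequality for `Y - X` under the tilted
measure. -/
theorem logLaplace_sub_le_integral_tilted [NeZero P] (hX : HasExpMoments P X)
    (hY : HasExpMoments P Y) :
    logLaplace P X - logLaplace P Y ≤ ∫ o, (X o - Y o) ∂(P.tilted X) := by
  have := isProbabilityMeasure_tilted hX.integrable_exp
  have hjensen := integral_le_logLaplace ((hY.sub hX).tilted hX)
  have hlog : logLaplace (P.tilted X) (fun o => Y o - X o) = logLaplace P Y - logLaplace P X := by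
    simp only [logLaplace, integral_exp_tilted, Pi.add_apply, add_sub_cancel]
    exact Real.log_div (integral_exp_pos hY.integrable_exp).ne'
      (integral_exp_pos hX.integrable_exp).ne'
  rw [← neg_sub (logLaplace P Y), ← hlog, neg_le, ← integral_neg]
  simpa only [neg_sub] using hjensen

theorem mul_integral_tilted_le_logLaplace_sub [NeZero P] (hX : HasExpMoments P X)
    (hY : HasExpMoments P Y) (δ : ℝ) :
    δ * ∫ o, X o ∂(P.tilted Y) ≤ logLaplace P (fun o => Y o + δ * X o) - logLaplace P Y := by
  have h := logLaplace_sub_le_integral_tilted hY (hY.add (hX.const_mul δ))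
  simp only [sub_add_cancel_left, integral_neg, integral_const_mul] at h
  linarith

/-- The Cauchy–Schwarz inequality for the weights `exp (Y / 2)` and `exp (-Y / 2)`. -/
theorem sq_integral_le_integral_mul_exp {ψ : Ω → ℝ} (h0 : ∀ o, 0 ≤ ψ o) (hψ : Integrable ψ P)
    (hpos : Integrable (fun o => ψ o * Real.exp (Y o)) P)
    (hneg : Integrable (fun o => ψ o * Real.exp (-Y o)) P) :
    (∫ o, ψ o ∂P) ^ 2 ≤ (∫ o, ψ o * Real.exp (Y o) ∂P) * ∫ o, ψ o * Real.exp (-Y o) ∂P := by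
  have hdiscrim : discrim (∫ o, ψ o * Real.exp (Y o) ∂P) (2 * ∫ o, ψ o ∂P)
      (∫ o, ψ o * Real.exp (-Y o) ∂P) ≤ 0 := by
    refine discrim_le_zero fun t => ?_
    have hsq : ∀ o, ψ o * Real.exp (Y o) * (t * t) + ψ o * (2 * t) + ψ o * Real.exp (-Y o)
        = ψ o * Real.exp (-Y o) * (t * Real.exp (Y o) + 1) ^ 2 := fun o => by
      rw [Real.exp_neg]; field_simp; ring
    have hlinear : Integrable (fun o => ψ o * Real.exp (Y o) * (t * t) + ψ o * (2 * t)) P :=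
      (hpos.mul_const _).add (hψ.mul_const _)
    calc 0 ≤ ∫ o, ψ o * Real.exp (-Y o) * (t * Real.exp (Y o) + 1) ^ 2 ∂P :=
          integral_nonneg fun o => by have := h0 o; positivity
      _ = _ := by
        simp only [← hsq]
        rw [integral_add hlinear hneg, integral_add (hpos.mul_const _) (hψ.mul_const _),
          integral_mul_const, integral_mul_const]
        ring
  rw [discrim] at hdiscrim
  linarith

/-- A change of measure with exponential density cannot make a likely event negligible. -/
theorem sq_integral_le_mul_integral_tilted [NeZero P] (hY : HasExpMoments P Y) {ψ : Ω → ℝ}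
    (hψ : AEStronglyMeasurable ψ P) (h0 : ∀ o, 0 ≤ ψ o) (h1 : ∀ o, ψ o ≤ 1) :
    (∫ o, ψ o ∂P) ^ 2
      ≤ Real.exp (logLaplace P Y + logLaplace P fun o => -Y o) * ∫ o, ψ o ∂(P.tilted Y) := by
  have integrable_mul {Z : Ω → ℝ} (hZ : HasExpMoments P Z) :
      Integrable (fun o => ψ o * Real.exp (Z o)) P :=
    hZ.integrable_exp.bdd_mul hψ
      (.of_forall fun o => (Real.norm_of_nonneg (h0 o)).trans_le (h1 o))
  have exp_logLaplace {Z : Ω → ℝ} (hZ : HasExpMoments P Z) :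
      Real.exp (logLaplace P Z) = ∫ o, Real.exp (Z o) ∂P :=
    Real.exp_log (integral_exp_pos hZ.integrable_exp)
  have hψint : Integrable ψ P := by simpa using integrable_mul (hY.const_mul 0)
  have htilted : ∫ o, ψ o * Real.exp (Y o) ∂P
      = Real.exp (logLaplace P Y) * ∫ o, ψ o ∂(P.tilted Y) := by
    have hne := (integral_exp_pos hY.integrable_exp).ne'
    rw [integral_tilted, exp_logLaplace hY, ← integral_const_mul]
    congr with o
    rw [smul_eq_mul]; field_simp
  calc (∫ o, ψ o ∂P) ^ 2
      ≤ (∫ o, ψ o * Real.exp (Y o) ∂P) * ∫ o, ψ o * Real.exp (-Y o) ∂P :=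
        sq_integral_le_integral_mul_exp h0 hψint (integrable_mul hY) (integrable_mul hY.neg)
    _ ≤ (∫ o, ψ o * Real.exp (Y o) ∂P) * Real.exp (logLaplace P fun o => -Y o) := by
      refine mul_le_mul_of_nonneg_left ?_
        (integral_nonneg fun o => mul_nonneg (h0 o) (Real.exp_pos _).le)
      rw [exp_logLaplace hY.neg]
      exact integral_mono (integrable_mul hY.neg) hY.neg.integrable_exp fun o =>
        mul_le_of_le_one_left (Real.exp_pos _).le (h1 o)
    _ = _ := by rw [htilted, Real.exp_add]; ring

end LogLaplace

/-- The oscillation of `φ` relative to the weight `w` is at most `D`. -/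
def SpanLE {X : Type*} (w : X → ℝ) (D : ℝ) (φ : X → ℝ) : Prop :=
  ∀ x y, φ x - φ y ≤ D * (w x + w y)

/-- The measures `μ₁` and `μ₂` share mass at least `η`; for probability measures this says that
their total variation distance is at most `1 - η`. Test functions are used in place of sets. -/
def OverlapGE {X : Type*} [MeasurableSpace X] (η : ℝ) (μ₁ μ₂ : Measure X) : Prop :=
  ∀ χ : X → ℝ, Measurable χ → (∀ x, 0 ≤ χ x) → (∀ x, χ x ≤ 1) →
    η ≤ ∫ x, χ x ∂μ₁ + ∫ x, (1 - χ x) ∂μ₂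

namespace SpanLE

variable {X : Type*} {w φ ψ f g : X → ℝ} {D E : ℝ}

theorem abs_sub_le (h : SpanLE w D φ) (x y : X) : |φ x - φ y| ≤ D * (w x + w y) :=
  abs_le.2 ⟨by linarith [h y x], h x y⟩

theorem abs_sub_le_of_eq_at (h : SpanLE w D (f - g)) {a : X} (ha : f a = g a) (x : X) :
    |f x - g x| ≤ D * (w x + w a) := by
  simpa only [Pi.sub_apply, ha, sub_self, sub_zero] using h.abs_sub_le x a

theorem add (h : SpanLE w D φ) (h' : SpanLE w E ψ) : SpanLE w (D + E) (φ + ψ) := fun x y => by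
  simp only [Pi.add_apply]
  linarith [h x y, h' x y]

theorem neg (h : SpanLE w D φ) : SpanLE w D (-φ) := fun x y => by
  simp only [Pi.neg_apply]
  linarith [h y x]

theorem of_abs_le (h : ∀ x, |φ x| ≤ D * w x) : SpanLE w D φ := fun x y => by
  linarith [le_of_abs_le (h x), neg_le_of_abs_le (h y)]

theorem of_eq_add_const (h : SpanLE w D φ) {c : ℝ} (hψ : ∀ x, ψ x = φ x + c) : SpanLE w D ψ :=
  fun x y => by simpa only [hψ, add_sub_add_right_eq_sub] using h x y

theorem of_abs_le_mul_one_add {β C : ℝ} (hβ : β ∈ Ioc (0 : ℝ) 1) (hC : 0 ≤ C)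
    (h : ∀ x, |φ x| ≤ C * (1 + w x)) : SpanLE (fun x => 1 + β * w x) (C / β) φ :=
  .of_abs_le fun x => calc
    |φ x| ≤ C * (1 + w x) := h x
    _ = C / β * (β + β * w x) := by have := hβ.1; field_simp
    _ ≤ C / β * (1 + β * w x) :=
      mul_le_mul_of_nonneg_left (by linarith [hβ.2]) (div_nonneg hC hβ.1.le)

theorem exists_abs_sub_const_le [Nonempty X] (h : SpanLE w D φ) :
    ∃ c, ∀ x, |φ x - c| ≤ D * w x := by
  have hle : ∀ x y, φ x - D * w x ≤ φ y + D * w y := fun x y => by linarith [h x y]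
  obtain ⟨c, hlower, hupper⟩ : ∃ c, (∀ x, φ x - D * w x ≤ c) ∧ ∀ y, c ≤ φ y + D * w y :=
    ⟨⨆ x, (φ x - D * w x), fun x => le_ciSup (f := fun x => φ x - D * w x)
      ⟨_, forall_mem_range.2 fun x => hle x (Classical.arbitrary X)⟩ x,
      fun y => ciSup_le fun x => hle x y⟩
  exact ⟨c, fun x => abs_le.2 ⟨by linarith [hupper x], by linarith [hlower x]⟩⟩

theorem eq_of_forall_pow {α : ℝ} (hα0 : 0 ≤ α) (hα1 : α < 1)
    (h : ∀ n : ℕ, SpanLE w (α ^ n * D) φ) (x y : X) : φ x = φ y := by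
  have hlim : Filter.Tendsto (fun n : ℕ => α ^ n * D * (w x + w y)) Filter.atTop (nhds 0) := by
    simpa using ((tendsto_pow_atTop_nhds_zero_of_lt_one hα0 hα1).mul_const D).mul_const (w x + w y)
  have habs : |φ x - φ y| ≤ 0 := ge_of_tendsto' hlim fun n => (h n).abs_sub_le x y
  exact sub_eq_zero.1 (abs_nonpos_iff.1 habs)

end SpanLE

namespace OverlapGE

variable {X : Type*} [MeasurableSpace X] {μ₁ μ₂ : Measure X} [IsProbabilityMeasure μ₁]
  [IsProbabilityMeasure μ₂] {η D : ℝ}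

theorem integral_sub_le_of_abs_le (h : OverlapGE η μ₁ μ₂) (hD : 0 ≤ D) {r : X → ℝ}
    (hr : Measurable r) (hrD : ∀ x, |r x| ≤ D) :
    ∫ x, r x ∂μ₁ - ∫ x, r x ∂μ₂ ≤ 2 * D * (1 - η) := by
  obtain rfl | hD := hD.eq_or_lt
  · simp [show r = 0 from funext fun x => abs_nonpos_iff.1 (hrD x)]
  have hint (μ : Measure X) [IsProbabilityMeasure μ] : Integrable r μ :=
    .of_bound hr.aestronglyMeasurable D (.of_forall hrD)
  have hintegral (μ : Measure X) [IsProbabilityMeasure μ] :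
      ∫ x, (2 * D)⁻¹ * (D - r x) ∂μ = (2 * D)⁻¹ * (D - ∫ x, r x ∂μ) := by
    rw [integral_const_mul, integral_sub (integrable_const D) (hint μ)]
    simp
  have hη := h (fun x => (2 * D)⁻¹ * (D - r x)) ((hr.const_sub D).const_mul _)
    (fun x => mul_nonneg (by positivity) (sub_nonneg.2 (le_of_abs_le (hrD x))))
    (fun x => by
      rw [inv_mul_le_one₀ (by positivity)]
      linarith [neg_le_of_abs_le (hrD x)])
  have hχint : Integrable (fun x => (2 * D)⁻¹ * (D - r x)) μ₂ :=
    ((integrable_const D).sub (hint μ₂)).const_mul _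
  rw [integral_sub (integrable_const 1) hχint, hintegral, hintegral, integral_const,
    probReal_univ, one_smul] at hη
  field_simp at hη
  linarith

/-- Truncating `φ - c` at `±D`, where `|φ - c| ≤ D w`, separates a bounded part, to which the
overlap applies, from a remainder of size `D (w - 1)`. -/
theorem integral_sub_le_of_spanLE (h : OverlapGE η μ₁ μ₂) (hD : 0 ≤ D) {w φ : X → ℝ}
    (hw1 : ∀ x, 1 ≤ w x) (hφ : Measurable φ) (hwφ : SpanLE w D φ)
    (hw₁ : Integrable w μ₁) (hw₂ : Integrable w μ₂) :
    ∫ x, φ x ∂μ₁ - ∫ x, φ x ∂μ₂ ≤ D * (∫ x, w x ∂μ₁ + ∫ x, w x ∂μ₂ - 2 * η) := by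
  have := μ₁.nonempty_of_neZero
  obtain ⟨c, hc⟩ := hwφ.exists_abs_sub_const_le
  let r : X → ℝ := fun x => max (-D) (min D (φ x - c))
  have hr : Measurable r := measurable_const.max (measurable_const.min (hφ.sub_const c))
  have hrD : ∀ x, |r x| ≤ D := fun x =>
    abs_le.2 ⟨le_max_left _ _, max_le (by linarith) (min_le_left _ _)⟩
  have hremainder : ∀ x, |φ x - c - r x| ≤ D * (w x - 1) := fun x => by
    have hx := abs_le.1 (hc x)
    have hnonneg := mul_nonneg hD (sub_nonneg.2 (hw1 x))
    rw [abs_le]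
    simp only [r]
    rcases max_cases (-D) (min D (φ x - c)) with ⟨hmax, _⟩ | ⟨hmax, _⟩ <;>
      rcases min_cases D (φ x - c) with ⟨hmin, _⟩ | ⟨hmin, _⟩ <;>
      constructor <;> linarith
  have hbound (μ : Measure X) [IsProbabilityMeasure μ] (hμ : Integrable w μ) :
      |∫ x, φ x ∂μ - c - ∫ x, r x ∂μ| ≤ D * (∫ x, w x ∂μ - 1) := by
    have hrint : Integrable r μ := .of_bound hr.aestronglyMeasurable D (.of_forall hrD)
    have hsub : Integrable (fun x => φ x - c) μ :=
      (hμ.const_mul D).mono' (hφ.sub_const c).aestronglyMeasurable (.of_forall hc)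
    have hφint : Integrable φ μ := by
      simpa only [sub_eq_add_neg, integrable_add_const_iff] using hsub
    calc |∫ x, φ x ∂μ - c - ∫ x, r x ∂μ| = |∫ x, (φ x - c - r x) ∂μ| := by
          rw [integral_sub hsub hrint, integral_sub hφint (integrable_const c)]
          simp
      _ ≤ ∫ x, D * (w x - 1) ∂μ :=
        (abs_integral_le_integral_abs).trans <| integral_mono
          (hsub.sub hrint).abs
          ((hμ.sub (integrable_const 1)).const_mul D) hremainder
      _ = _ := by
        rw [integral_const_mul, integral_sub hμ (integrable_const 1)]
        simp
  linarith [h.integral_sub_le_of_abs_le hD hr hrD, le_of_abs_le (hbound μ₁ hw₁),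
    neg_le_of_abs_le (hbound μ₂ hw₂)]

theorem zero {X : Type*} [MeasurableSpace X] (μ₁ μ₂ : Measure X) : OverlapGE 0 μ₁ μ₂ :=
  fun _ _ h0 h1 => add_nonneg (integral_nonneg h0) (integral_nonneg fun x => sub_nonneg.2 (h1 x))

/-- The two squared masses add up to at least `ν(1)² / 2` whichever way `χ` splits `ν`. -/
theorem of_sq_integral_le {X : Type*} [MeasurableSpace X] {μ₁ μ₂ ν : Measure X}
    [IsFiniteMeasure ν] {Q : ℝ} (hQ : 0 < Q)
    (h₁ : ∀ χ : X → ℝ, Measurable χ → (∀ x, 0 ≤ χ x) → (∀ x, χ x ≤ 1) →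
      (∫ x, χ x ∂ν) ^ 2 ≤ Q * ∫ x, χ x ∂μ₁)
    (h₂ : ∀ χ : X → ℝ, Measurable χ → (∀ x, 0 ≤ χ x) → (∀ x, χ x ≤ 1) →
      (∫ x, χ x ∂ν) ^ 2 ≤ Q * ∫ x, χ x ∂μ₂) :
    OverlapGE (ν.real univ ^ 2 / (2 * Q)) μ₁ μ₂ := fun χ hχ h0 h1 => by
  have hsq₁ := h₁ χ hχ h0 h1
  have hsq₂ := h₂ (fun x => 1 - χ x) (hχ.const_sub 1) (fun x => sub_nonneg.2 (h1 x))
    fun x => sub_le_self 1 (h0 x)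
  have hint : Integrable χ ν := .of_bound hχ.aestronglyMeasurable 1
    (.of_forall fun x => (Real.norm_of_nonneg (h0 x)).trans_le (h1 x))
  rw [integral_sub (integrable_const 1) hint, integral_const, smul_eq_mul, mul_one] at hsq₂
  have htotal := add_sq_le (a := ∫ x, χ x ∂ν) (b := ν.real univ - ∫ x, χ x ∂ν)
  rw [add_sub_cancel] at htotal
  rw [div_le_iff₀ (by positivity)]
  linarith

end OverlapGE

/-- The rate `α = 1 - t` has to absorb the overlap `η` for small `s` and the drift for large `s`. -/
theorem exists_harris_constants {b K η R : ℝ} (hb0 : 0 ≤ b) (hb1 : b < 1) (hK : 0 ≤ K)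
    (hη : 0 < η) (hR0 : 0 < R) (hR : 4 * K ≤ (1 - b) * R) :
    ∃ β ∈ Ioc (0 : ℝ) 1, ∃ α ∈ Ico (0 : ℝ) 1,
      (∀ s, 0 ≤ s → 2 + β * (2 * K + b * s) - 2 * η ≤ α * (2 + β * s)) ∧
      ∀ s, R ≤ s → 2 + β * (2 * K + b * s) ≤ α * (2 + β * s) := by
  have hb : 0 < 1 - b := sub_pos.2 hb1
  obtain ⟨β, hβ0, hβ1, hβK⟩ : ∃ β : ℝ, 0 < β ∧ β ≤ 1 ∧ 2 * K * β ≤ η := by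
    refine ⟨min 1 (η / (2 * K + 1)), by positivity, min_le_left _ _, ?_⟩
    have hle : min 1 (η / (2 * K + 1)) * (2 * K + 1) ≤ η :=
      (le_div_iff₀ (by positivity)).1 (min_le_right _ _)
    have hpos : 0 < min 1 (η / (2 * K + 1)) := by positivity
    linarith
  obtain ⟨t, ht0, htb, htR, htη⟩ :
      ∃ t : ℝ, 0 < t ∧ 4 * t ≤ 1 - b ∧ 8 * t ≤ β * ((1 - b) * R) ∧ 2 * t ≤ η := by
    refine ⟨min ((1 - b) / 4) (min (β * ((1 - b) * R) / 8) (η / 2)), by positivity, ?_, ?_, ?_⟩ <;>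
      linarith [min_le_left ((1 - b) / 4) (min (β * ((1 - b) * R) / 8) (η / 2)),
        min_le_right ((1 - b) / 4) (min (β * ((1 - b) * R) / 8) (η / 2)),
        min_le_left (β * ((1 - b) * R) / 8) (η / 2), min_le_right (β * ((1 - b) * R) / 8) (η / 2)]
  refine ⟨β, ⟨hβ0, hβ1⟩, 1 - t, ⟨by linarith, by linarith⟩, fun s hs => ?_, fun s hs => ?_⟩
  · have hdrift : 0 ≤ β * s * (1 - b - t) :=
      mul_nonneg (mul_nonneg hβ0.le hs) (by linarith)
    linarith
  · have hs0 : 0 ≤ β * s := mul_nonneg hβ0.le (hR0.le.trans hs)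
    have hrate : β * s * (4 * t) ≤ β * s * (1 - b) := mul_le_mul_of_nonneg_left htb hs0
    have hK' : β * (4 * K) ≤ β * ((1 - b) * R) := mul_le_mul_of_nonneg_left hR hβ0.le
    have hR' : β * ((1 - b) * R) ≤ β * ((1 - b) * s) :=
      mul_le_mul_of_nonneg_left (mul_le_mul_of_nonneg_left hs hb.le) hβ0.le
    linarith

/-- Harris' theorem in the form of Hairer and Mattingly: the contraction comes from the overlap when
both weights are at most `R`, and from the drift otherwise. -/
theorem exists_contraction_of_drift_of_overlap {X : Type*} [MeasurableSpace X] {ω : X → ℝ}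
    (hω : ∀ x, 0 ≤ ω x) {b K η R : ℝ} (hb0 : 0 ≤ b) (hb1 : b < 1) (hK : 0 ≤ K)
    (hη : 0 < η) (hR0 : 0 < R) (hR : 4 * K ≤ (1 - b) * R) :
    ∃ β ∈ Ioc (0 : ℝ) 1, ∃ α ∈ Ico (0 : ℝ) 1,
      ∀ (μ₁ μ₂ : Measure X) [IsProbabilityMeasure μ₁] [IsProbabilityMeasure μ₂] (x₁ x₂ : X),
        Integrable ω μ₁ → Integrable ω μ₂ →
        ∫ x, ω x ∂μ₁ ≤ K + b * ω x₁ → ∫ x, ω x ∂μ₂ ≤ K + b * ω x₂ →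
        (ω x₁ ≤ R → ω x₂ ≤ R → OverlapGE η μ₁ μ₂) →
        ∀ (φ : X → ℝ) (D : ℝ), Measurable φ → 0 ≤ D → SpanLE (fun x => 1 + β * ω x) D φ →
          ∫ x, φ x ∂μ₁ - ∫ x, φ x ∂μ₂ ≤ α * D * ((1 + β * ω x₁) + (1 + β * ω x₂)) := by
  obtain ⟨β, hβ, α, hα, hnear, hfar⟩ := exists_harris_constants hb0 hb1 hK hη hR0 hR
  refine ⟨β, hβ, α, hα, fun μ₁ μ₂ _ _ x₁ x₂ hω₁ hω₂ hdrift₁ hdrift₂ hoverlap φ D hφ hD hspan => ?_⟩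
  have hmean (μ : Measure X) [IsProbabilityMeasure μ] (hμ : Integrable ω μ) :
      ∫ x, (1 + β * ω x) ∂μ = 1 + β * ∫ x, ω x ∂μ := by
    rw [integral_add (integrable_const 1) (hμ.const_mul β), integral_const_mul]
    simp
  have hoverlap_le {ζ : ℝ} (hζ : OverlapGE ζ μ₁ μ₂) :
      ∫ x, φ x ∂μ₁ - ∫ x, φ x ∂μ₂
        ≤ D * (2 + β * (2 * K + b * (ω x₁ + ω x₂)) - 2 * ζ) := by
    refine (hζ.integral_sub_le_of_spanLE hD
      (fun x => le_add_of_nonneg_right (mul_nonneg hβ.1.le (hω x))) hφ hspan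
      ((integrable_const 1).add (hω₁.const_mul β))
      ((integrable_const 1).add (hω₂.const_mul β))).trans (mul_le_mul_of_nonneg_left ?_ hD)
    rw [hmean μ₁ hω₁, hmean μ₂ hω₂]
    have := mul_le_mul_of_nonneg_left (add_le_add hdrift₁ hdrift₂) hβ.1.le
    linarith
  have hrate : ∃ ζ, OverlapGE ζ μ₁ μ₂ ∧ 2 + β * (2 * K + b * (ω x₁ + ω x₂)) - 2 * ζ
      ≤ α * (2 + β * (ω x₁ + ω x₂)) := by
    by_cases hx : ω x₁ ≤ R ∧ ω x₂ ≤ R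
    · exact ⟨η, hoverlap hx.1 hx.2, hnear _ (add_nonneg (hω x₁) (hω x₂))⟩
    · have hsum : R ≤ ω x₁ + ω x₂ := by
        rcases not_and_or.1 hx with h | h <;> linarith [hω x₁, hω x₂]
      exact ⟨0, OverlapGE.zero μ₁ μ₂, by simpa using hfar _ hsum⟩
  obtain ⟨ζ, hζ, hle⟩ := hrate
  calc _ ≤ _ := hoverlap_le hζ
    _ ≤ D * (α * (2 + β * (ω x₁ + ω x₂))) := mul_le_mul_of_nonneg_left hle hD
    _ = _ := by ring

namespace SpanLE

section Limit

variable {X : Type*} {w : X → ℝ} {α D : ℝ} {u : ℕ → X → ℝ} {a : X} {p : ℝ}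

theorem exists_limit (hα1 : α < 1) (a : X) (p : ℝ)
    (hu : ∀ n, SpanLE w (α ^ n * D) (u (n + 1) - u n)) :
    ∃ v : X → ℝ, v a = p ∧ ∀ n, SpanLE w (α ^ n * (D / (1 - α))) (v - u n) := by
  have hdist : ∀ x y n, dist (u n x - u n y) (u (n + 1) x - u (n + 1) y)
      ≤ D * (w x + w y) * α ^ n := fun x y n => by
    rw [dist_comm, Real.dist_eq, sub_sub_sub_comm]
    exact ((hu n).abs_sub_le x y).trans_eq (by ring)
  have hlim : ∀ x, ∃ l, Filter.Tendsto (fun n => u n x - u n a) Filter.atTop (nhds l) := fun x =>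
    cauchySeq_tendsto_of_complete (cauchySeq_of_le_geometric α _ hα1 (hdist x a))
  choose l hl using hlim
  have hla : l a = 0 := tendsto_nhds_unique (hl a) (by simp)
  refine ⟨fun x => l x + p, by simp [hla], fun n x y => ?_⟩
  have hlxy : Filter.Tendsto (fun n => u n x - u n y) Filter.atTop (nhds (l x - l y)) := by
    simpa using (hl x).sub (hl y)
  have htail := dist_le_of_le_geometric_of_tendsto α _ hα1 (hdist x y) hlxy n
  rw [dist_comm, Real.dist_eq] at htail
  calc (l x + p - u n x) - (l y + p - u n y) = (l x - l y) - (u n x - u n y) := by ring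
    _ ≤ _ := (le_abs_self _).trans htail
    _ = _ := by ring

theorem continuous_of_geometric [TopologicalSpace X] (hw : Continuous w) (hD : 0 ≤ D)
    (hα0 : 0 ≤ α) (hα1 : α < 1) (hcont : ∀ n, Continuous (u n)) (hua : ∀ n, u n a = p)
    {v : X → ℝ} (hva : v a = p) (hv : ∀ n, SpanLE w (α ^ n * D) (v - u n)) : Continuous v := by
  have hloc : TendstoLocallyUniformly u v Filter.atTop := by
    rw [Metric.tendstoLocallyUniformly_iff]
    intro ε hε x
    refine ⟨{y | w y < w x + 1}, (isOpen_lt hw continuous_const).mem_nhds (by simp), ?_⟩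
    have hlim : Filter.Tendsto (fun n : ℕ => α ^ n * D * (w x + 1 + w a)) Filter.atTop
        (nhds 0) := by
      simpa using ((tendsto_pow_atTop_nhds_zero_of_lt_one hα0 hα1).mul_const D).mul_const
        (w x + 1 + w a)
    filter_upwards [hlim.eventually_lt_const hε] with n hn y hy
    calc dist (v y) (u n y) ≤ α ^ n * D * (w y + w a) :=
          (hv n).abs_sub_le_of_eq_at (hva.trans (hua n).symm) y
      _ ≤ α ^ n * D * (w x + 1 + w a) := by gcongr
      _ < ε := hn
  exact hloc.continuous (Filter.Frequently.of_forall hcont)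

end Limit

/-- The continuous functions with the same value at `a` as `u₀` whose difference with `u₀` has
weighted oscillation at most `ρ`. -/
def closedBall {X : Type*} [TopologicalSpace X] (w : X → ℝ) (a : X) (u₀ : X → ℝ) (ρ : ℝ) :
    Set (X → ℝ) :=
  {f | Continuous f ∧ f a = u₀ a ∧ SpanLE w ρ (f - u₀)}

theorem exists_fixedPoint_of_contraction {X : Type*} [TopologicalSpace X] {w : X → ℝ}
    (hw : Continuous w) (hw0 : ∀ x, 0 ≤ w x) {a : X} {u₀ : X → ℝ} (hu₀ : Continuous u₀)
    {α ρ : ℝ} (hα0 : 0 ≤ α) (hα1 : α < 1) (hρ : 0 ≤ ρ) {S : (X → ℝ) → X → ℝ}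
    (hcont : ∀ f ∈ closedBall w a u₀ ρ, Continuous (S f)) (hpin : ∀ f, S f a = u₀ a)
    (hcontr : ∀ f ∈ closedBall w a u₀ ρ, ∀ g ∈ closedBall w a u₀ ρ, ∀ D, 0 ≤ D →
      SpanLE w D (f - g) → SpanLE w (α * D) (S f - S g))
    (hstart : SpanLE w ((1 - α) * ρ) (S u₀ - u₀)) :
    ∃ v ∈ closedBall w a u₀ ρ, S v = v := by
  have hα : 0 < 1 - α := sub_pos.2 hα1
  have hD : 0 ≤ (1 - α) * ρ := mul_nonneg hα.le hρ
  have hu₀mem : u₀ ∈ closedBall w a u₀ ρ :=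
    ⟨hu₀, rfl, of_abs_le fun x => by simpa using mul_nonneg hρ (hw0 x)⟩
  have hmaps : MapsTo S (closedBall w a u₀ ρ) (closedBall w a u₀ ρ) := fun f hf =>
    ⟨hcont f hf, hpin f, by
      simpa only [sub_add_sub_cancel, ← add_mul, add_sub_cancel, one_mul] using
        (hcontr f hf u₀ hu₀mem ρ hρ hf.2.2).add hstart⟩
  have hmem : ∀ n, S^[n] u₀ ∈ closedBall w a u₀ ρ := fun n => hmaps.iterate n hu₀mem
  have hincr : ∀ n, SpanLE w (α ^ n * ((1 - α) * ρ)) (S^[n + 1] u₀ - S^[n] u₀) := fun n => by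
    induction n with
    | zero => simpa using hstart
    | succ n ih =>
      simpa only [pow_succ', mul_assoc, Function.iterate_succ_apply'] using
        hcontr _ (hmem (n + 1)) _ (hmem n) _ (mul_nonneg (pow_nonneg hα0 n) hD) ih
  obtain ⟨v, hva, hv⟩ := exists_limit (u := fun n => S^[n] u₀) hα1 a (u₀ a) hincr
  rw [mul_div_cancel_left₀ ρ hα.ne'] at hv
  have hvmem : v ∈ closedBall w a u₀ ρ :=
    ⟨continuous_of_geometric hw hρ hα0 hα1 (fun n => (hmem n).1) (fun n => (hmem n).2.1) hva hv,
      hva, by simpa using hv 0⟩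
  have hfixed : ∀ n : ℕ, SpanLE w (α ^ n * (2 * α * ρ)) (S v - v) := fun n => by
    have himage := hcontr _ hvmem _ (hmem n) _ (by positivity) (hv n)
    have hlimit := (hv (n + 1)).neg
    rw [Function.iterate_succ_apply', neg_sub] at hlimit
    have hsum := himage.add hlimit
    rwa [sub_add_sub_cancel, show α * (α ^ n * ρ) + α ^ (n + 1) * ρ = α ^ n * (2 * α * ρ) by ring]
      at hsum
  refine ⟨v, hvmem, funext fun x => ?_⟩
  have := eq_of_forall_pow hα0 hα1 hfixed x a
  simpa only [Pi.sub_apply, hpin, hva, sub_self, sub_eq_zero] using this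

end SpanLE

/-- The continuous functions bounded by `M` times the weight `1 + ω`. -/
def weightedBall {X : Type*} [TopologicalSpace X] (ω : X → ℝ) (M : ℝ) : Set (X → ℝ) :=
  {f | Continuous f ∧ ∀ x, |f x| ≤ M * (1 + ω x)}

namespace weightedBall

variable {X : Type*} [TopologicalSpace X] {ω : X → ℝ} {M M' : ℝ} {f g : X → ℝ}

theorem mono (hω : ∀ x, 0 ≤ ω x) (hM : M ≤ M') : weightedBall ω M ⊆ weightedBall ω M' :=
  fun _ hf => ⟨hf.1, fun x => (hf.2 x).trans <|
    mul_le_mul_of_nonneg_right hM (by linarith [hω x])⟩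

theorem nonneg (hf : f ∈ weightedBall ω M) {x : X} (hx : 0 ≤ ω x) : 0 ≤ M :=
  nonneg_of_mul_nonneg_left ((abs_nonneg _).trans (hf.2 x)) (by linarith)

theorem of_abs_sub_le (hf : f ∈ weightedBall ω M) (hg : Continuous g)
    (h : ∀ x, |g x - f x| ≤ M' * (1 + ω x)) : g ∈ weightedBall ω (M + M') :=
  ⟨hg, fun x => by linarith [abs_sub_abs_le_abs_sub (g x) (f x), hf.2 x, h x]⟩

end weightedBall

/-- The pair `(u, κ)` is an eigenpair of `T` in the additive (tropical) sense, `T u = u + κ`, with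
`u` of weighted growth. -/
structure IsAdditiveEigenpair {X : Type*} [TopologicalSpace X] (ω : X → ℝ)
    (T : (X → ℝ) → X → ℝ) (u : X → ℝ) (κ : ℝ) : Prop where
  mem_weightedBall : ∃ M, u ∈ weightedBall ω M
  map_eq : ∀ x, T u x = u x + κ

/-- A family of operators that commute with the addition of constants, are Lipschitz jointly in the
parameter and the function, and contract a weighted span. The constants, and the weight `1 + β ω`
of the span, may depend on the size `M` of the functions, but locally not on the parameter. -/
structure IsLocalSpanContraction {Θ X : Type*} [PseudoMetricSpace Θ] [TopologicalSpace X]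
    (ω : X → ℝ) (T : Θ → (X → ℝ) → X → ℝ) : Prop where
  continuous_map : ∀ θ M, ∀ f ∈ weightedBall ω M, Continuous (T θ f)
  map_add_const : ∀ θ M, ∀ f ∈ weightedBall ω M, ∀ c x, T θ (fun y => f y + c) x = T θ f x + c
  contracts : ∀ θ₀ M, ∃ β ∈ Ioc (0 : ℝ) 1, ∃ α ∈ Ico (0 : ℝ) 1, ∀ᶠ θ in nhds θ₀,
    ∀ f ∈ weightedBall ω M, ∀ g ∈ weightedBall ω M, ∀ D, 0 ≤ D →
      SpanLE (fun x => 1 + β * ω x) D (f - g) →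
        SpanLE (fun x => 1 + β * ω x) (α * D) (T θ f - T θ g)
  lipschitz : ∀ θ₀ M, ∃ K, 0 < K ∧ ∀ᶠ θ in nhds θ₀,
    ∀ f ∈ weightedBall ω M, ∀ g ∈ weightedBall ω M, ∀ e, 0 ≤ e →
      (∀ x, |f x - g x| ≤ e * (1 + ω x)) →
        ∀ x, |T θ f x - T θ₀ g x| ≤ K * (dist θ θ₀ + e) * (1 + ω x)

namespace IsLocalSpanContraction

variable {Θ X : Type*} [PseudoMetricSpace Θ] [TopologicalSpace X] {ω : X → ℝ}
  {T : Θ → (X → ℝ) → X → ℝ}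

theorem eigenpair_unique [Nonempty X] (hT : IsLocalSpanContraction ω T) (hω : ∀ x, 0 ≤ ω x)
    {θ : Θ} {u u' : X → ℝ} {κ κ' : ℝ} (hu : IsAdditiveEigenpair ω (T θ) u κ)
    (hu' : IsAdditiveEigenpair ω (T θ) u' κ') : κ' = κ ∧ ∃ c, ∀ x, u' x = u x + c := by
  obtain ⟨a⟩ := ‹Nonempty X›
  obtain ⟨M, hM⟩ := hu.mem_weightedBall
  obtain ⟨M', hM'⟩ := hu'.mem_weightedBall
  have hmax := weightedBall.mono hω (le_max_left M M') hM
  have hmax' := weightedBall.mono hω (le_max_right M M') hM'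
  obtain ⟨β, hβ, α, hα, hcontr⟩ := hT.contracts θ (max M M')
  have hsub : ∀ x, (u' - u) x = (T θ u' - T θ u) x + (κ - κ') := fun x => by
    simp only [Pi.sub_apply, hu.map_eq, hu'.map_eq]
    ring
  have hspan : ∀ n : ℕ, SpanLE (fun x => 1 + β * ω x) (α ^ n * ((M' + M) / β)) (u' - u) := by
    have hMM' := add_nonneg (weightedBall.nonneg hM' (hω a)) (weightedBall.nonneg hM (hω a))
    intro n
    induction n with
    | zero =>
      rw [pow_zero, one_mul]
      exact .of_abs_le_mul_one_add hβ hMM' fun x =>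
        (abs_sub (u' x) (u x)).trans (by linarith [hM.2 x, hM'.2 x])
    | succ n ih =>
      rw [pow_succ', mul_assoc]
      exact (hcontr.self_of_nhds _ hmax' _ hmax _
        (mul_nonneg (pow_nonneg hα.1 n) (div_nonneg hMM' hβ.1.le)) ih).of_eq_add_const hsub
  have hconst : ∀ x, u' x = u x + (u' a - u a) := fun x => by
    linarith [SpanLE.eq_of_forall_pow hα.1 hα.2 hspan x a, Pi.sub_apply u' u x,
      Pi.sub_apply u' u a]
  refine ⟨?_, _, hconst⟩
  have hmap := hT.map_add_const θ M u hM (u' a - u a) a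
  rw [← funext hconst, hu.map_eq, hu'.map_eq] at hmap
  linarith

theorem abs_sub_le_of_mem_closedBall {β ρ : ℝ} (hω : ∀ x, 0 ≤ ω x) (hβ1 : β ≤ 1) (hρ : 0 ≤ ρ)
    {a : X} {u₀ f : X → ℝ} (hf : f ∈ SpanLE.closedBall (fun x => 1 + β * ω x) a u₀ ρ) (x : X) :
    |f x - u₀ x| ≤ ρ * (2 + ω a) * (1 + ω x) := by
  have hweight : (1 + β * ω x) + (1 + β * ω a) ≤ (2 + ω a) * (1 + ω x) := by
    linarith [mul_le_of_le_one_left (hω x) hβ1, mul_le_of_le_one_left (hω a) hβ1, hω x,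
      mul_nonneg (hω a) (hω x)]
  rw [mul_assoc]
  exact (hf.2.2.abs_sub_le_of_eq_at hf.2.1 x).trans (mul_le_mul_of_nonneg_left hweight hρ)

/-- An eigenfunction is a fixed point of `f ↦ T f - T f a + u₀ a`. -/
theorem exists_eigenpair_mem_closedBall {β α ρ M : ℝ} {S : (X → ℝ) → X → ℝ}
    (hω : ∀ x, 0 ≤ ω x) (hωc : Continuous ω) (hβ : β ∈ Ioc (0 : ℝ) 1) (hα : α ∈ Ico (0 : ℝ) 1)
    (hρ : 0 ≤ ρ) {a : X} {u₀ : X → ℝ} (hu₀ : Continuous u₀)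
    (hball : SpanLE.closedBall (fun x => 1 + β * ω x) a u₀ ρ ⊆ weightedBall ω M)
    (hcont : ∀ f ∈ weightedBall ω M, Continuous (S f))
    (hcontr : ∀ f ∈ weightedBall ω M, ∀ g ∈ weightedBall ω M, ∀ D, 0 ≤ D →
      SpanLE (fun x => 1 + β * ω x) D (f - g) → SpanLE (fun x => 1 + β * ω x) (α * D) (S f - S g))
    (hstart : SpanLE (fun x => 1 + β * ω x) ((1 - α) * ρ) (S u₀ - u₀)) :
    ∃ v ∈ SpanLE.closedBall (fun x => 1 + β * ω x) a u₀ ρ, ∃ κ, IsAdditiveEigenpair ω S v κ := by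
  obtain ⟨v, hv, hfixed⟩ := SpanLE.exists_fixedPoint_of_contraction
    (S := fun f x => S f x + (u₀ a - S f a)) (a := a) (by fun_prop)
    (fun x => add_nonneg zero_le_one (mul_nonneg hβ.1.le (hω x))) hu₀ hα.1 hα.2 hρ
    (fun f hf => (hcont f (hball hf)).add_const _) (fun f => by simp)
    (fun f hf g hg D hD h => (hcontr f (hball hf) g (hball hg) D hD h).of_eq_add_const
      (c := S g a - S f a) fun x => by simp only [Pi.sub_apply]; ring)
    (hstart.of_eq_add_const (c := u₀ a - S u₀ a) fun x => by simp only [Pi.sub_apply]; ring)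
  exact ⟨v, hv, S v a - u₀ a, ⟨M, hball hv⟩, fun x => by linarith [congrFun hfixed x]⟩

theorem eventually_exists_eigenpair_near (hT : IsLocalSpanContraction ω T) (hω : ∀ x, 0 ≤ ω x)
    (hωc : Continuous ω) {θ₀ : Θ} {u₀ : X → ℝ} {κ₀ : ℝ}
    (hu₀ : IsAdditiveEigenpair ω (T θ₀) u₀ κ₀) (a : X) {ε : ℝ} (hε : 0 < ε) :
    ∀ᶠ θ in nhds θ₀, ∃ v κ, IsAdditiveEigenpair ω (T θ) v κ ∧ v a = u₀ a ∧
      ∀ x, |v x - u₀ x| ≤ ε * (1 + ω x) := by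
  have ha := hω a
  obtain ⟨M₀, hM₀⟩ := hu₀.mem_weightedBall
  obtain ⟨β, hβ, α, hα, hcontr⟩ := hT.contracts θ₀ (M₀ + 1)
  obtain ⟨K, hK, hlip⟩ := hT.lipschitz θ₀ (M₀ + 1)
  have hu₀mem := weightedBall.mono hω (le_add_of_nonneg_right zero_le_one) hM₀
  obtain ⟨ρ, hρ, hρ1, hρε⟩ : ∃ ρ : ℝ, 0 < ρ ∧ ρ * (2 + ω a) ≤ 1 ∧ ρ * (2 + ω a) ≤ ε :=
    ⟨min 1 ε / (2 + ω a), by positivity, by rw [div_mul_cancel₀ _ (by positivity)]; simp,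
      by rw [div_mul_cancel₀ _ (by positivity)]; simp⟩
  have hball : SpanLE.closedBall (fun x => 1 + β * ω x) a u₀ ρ ⊆ weightedBall ω (M₀ + 1) :=
    fun f hf => weightedBall.of_abs_sub_le hM₀ hf.1 fun x =>
      (abs_sub_le_of_mem_closedBall hω hβ.2 hρ.le hf x).trans
        (mul_le_mul_of_nonneg_right hρ1 (by linarith [hω x]))
  have hα1 : 0 < 1 - α := sub_pos.2 hα.2
  have hβ0 := hβ.1
  have hnhds : Metric.ball θ₀ (β * ((1 - α) * ρ) / K) ∈ nhds θ₀ :=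
    Metric.ball_mem_nhds θ₀ (by positivity)
  filter_upwards [hcontr, hlip, hnhds] with θ hcontrθ hlipθ hθ
  have hdist : K * dist θ θ₀ ≤ β * ((1 - α) * ρ) := by
    rw [mul_comm, ← le_div_iff₀ hK]; exact (Metric.mem_ball.1 hθ).le
  have hstart : SpanLE (fun x => 1 + β * ω x) ((1 - α) * ρ) (T θ u₀ - u₀) := by
    have hclose : SpanLE (fun x => 1 + β * ω x) (β * ((1 - α) * ρ) / β) (T θ u₀ - T θ₀ u₀) :=
      .of_abs_le_mul_one_add hβ (by positivity) fun x => by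
        have hx : 0 ≤ 1 + ω x := by linarith [hω x]
        have := hlipθ u₀ hu₀mem u₀ hu₀mem 0 le_rfl (by simp) x
        rw [add_zero] at this
        exact this.trans (mul_le_mul_of_nonneg_right hdist hx)
    rw [mul_div_cancel_left₀ _ hβ0.ne'] at hclose
    exact hclose.of_eq_add_const (c := κ₀) fun x => by
      simp only [Pi.sub_apply, hu₀.map_eq]; ring
  obtain ⟨v, hv, κ, hκ⟩ := exists_eigenpair_mem_closedBall hω hωc hβ hα hρ.le hM₀.1 hball
    (hT.continuous_map θ _) hcontrθ hstart
  exact ⟨v, κ, hκ, hv.2.1, fun x => (abs_sub_le_of_mem_closedBall hω hβ.2 hρ.le hv x).trans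
    (mul_le_mul_of_nonneg_right hρε (by linarith [hω x]))⟩

theorem eventually_eigenpair_near (hT : IsLocalSpanContraction ω T) (hω : ∀ x, 0 ≤ ω x)
    (hωc : Continuous ω) {θ₀ : Θ} {u₀ : X → ℝ} {κ₀ : ℝ}
    (hu₀ : IsAdditiveEigenpair ω (T θ₀) u₀ κ₀) (a : X) {ε : ℝ} (hε : 0 < ε) :
    ∀ᶠ θ in nhds θ₀, ∀ u κ, IsAdditiveEigenpair ω (T θ) u κ →
      |κ - κ₀| ≤ ε ∧ ∀ x, |u x - u a - (u₀ x - u₀ a)| ≤ ε * (1 + ω x) := by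
  have : Nonempty X := ⟨a⟩
  have ha := hω a
  obtain ⟨M₀, hM₀⟩ := hu₀.mem_weightedBall
  obtain ⟨K, hK, hlip⟩ := hT.lipschitz θ₀ (M₀ + 1)
  obtain ⟨e, he, he1, heε, heK⟩ :
      ∃ e : ℝ, 0 < e ∧ e ≤ 1 ∧ e ≤ ε ∧ K * (e + e) * (1 + ω a) ≤ ε := by
    refine ⟨min 1 (min ε (ε / (2 * K * (1 + ω a)))), by positivity, min_le_left _ _,
      (min_le_right _ _).trans (min_le_left _ _), ?_⟩
    have hle := (le_div_iff₀ (by positivity)).1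
      ((min_le_right 1 _).trans (min_le_right ε (ε / (2 * K * (1 + ω a)))))
    linarith
  filter_upwards [hT.eventually_exists_eigenpair_near hω hωc hu₀ a he, hlip,
    Metric.ball_mem_nhds θ₀ he] with θ ⟨v, κv, hv, hva, hvu₀⟩ hlipθ hθ u κ hu
  obtain ⟨rfl, c, hc⟩ := hT.eigenpair_unique hω hv hu
  obtain ⟨M, hM⟩ := hv.mem_weightedBall
  have hvmem : v ∈ weightedBall ω (M₀ + 1) := weightedBall.of_abs_sub_le hM₀ hM.1 fun x =>
    (hvu₀ x).trans (mul_le_mul_of_nonneg_right he1 (by linarith [hω x]))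
  refine ⟨?_, fun x => ?_⟩
  · have hle := hlipθ v hvmem u₀ (weightedBall.mono hω (by linarith) hM₀) e he.le hvu₀ a
    rw [hv.map_eq, hu₀.map_eq, hva, add_sub_add_left_eq_sub] at hle
    refine hle.trans (le_trans ?_ heK)
    gcongr
    exact (Metric.mem_ball.1 hθ).le
  · rw [hc, hc, hva, add_sub_add_right_eq_sub, sub_sub_sub_cancel_right]
    exact (hvu₀ x).trans (mul_le_mul_of_nonneg_right heε (by linarith [hω x]))

theorem continuousOn_eigenpair [Nonempty X] (hT : IsLocalSpanContraction ω T)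
    (hω : ∀ x, 0 ≤ ω x) (hωc : Continuous ω) {S : Set Θ} {u : Θ → X → ℝ} {κ : Θ → ℝ}
    (hu : ∀ θ ∈ S, IsAdditiveEigenpair ω (T θ) (u θ) (κ θ)) :
    ContinuousOn κ S ∧ ∀ a x, ContinuousOn (fun θ => u θ x - u θ a) S := by
  have hnear : ∀ θ₀ ∈ S, ∀ a, ∀ ε > 0, ∀ᶠ θ in nhdsWithin θ₀ S, |κ θ - κ θ₀| ≤ ε ∧
      ∀ x, |u θ x - u θ a - (u θ₀ x - u θ₀ a)| ≤ ε * (1 + ω x) := fun θ₀ hθ₀ a ε hε => by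
    filter_upwards [nhdsWithin_le_nhds (hT.eventually_eigenpair_near hω hωc (hu θ₀ hθ₀) a hε),
      self_mem_nhdsWithin] with θ h hθ
    exact h _ _ (hu θ hθ)
  refine ⟨fun θ₀ hθ₀ => Metric.continuousWithinAt_iff'.2 fun ε hε => ?_,
    fun a x θ₀ hθ₀ => Metric.continuousWithinAt_iff'.2 fun ε hε => ?_⟩
  · obtain ⟨a⟩ := ‹Nonempty X›
    filter_upwards [hnear θ₀ hθ₀ a (ε / 2) (half_pos hε)] with θ h
    exact h.1.trans_lt (half_lt_self hε)
  · have hx : 0 < 1 + ω x := by linarith [hω x]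
    filter_upwards [hnear θ₀ hθ₀ a (ε / 2 / (1 + ω x)) (by positivity)] with θ h
    have hle := h.2 x
    rw [div_mul_cancel₀ _ hx.ne'] at hle
    exact hle.trans_lt (half_lt_self hε)

end IsLocalSpanContraction

theorem iInf_le_iInf_add {ι : Type*} [Nonempty ι] {p q : ι → ℝ} (hp : BddBelow (range p)) {C : ℝ}
    (h : ∀ i, p i ≤ q i + C) : ⨅ i, p i ≤ (⨅ i, q i) + C :=
  sub_le_iff_le_add.1 <| le_ciInf fun i => sub_le_iff_le_add.2 <| (ciInf_le hp i).trans (h i)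

theorem iInf_sub_iInf_sub_le {ι : Type*} [Nonempty ι] {p q p' q' : ι → ℝ}
    (hp : BddBelow (range p)) (hq' : BddBelow (range q')) {B : ℝ}
    (h : ∀ i j, p i - q i + (q' j - p' j) ≤ B) :
    ((⨅ i, p i) - ⨅ i, q i) - ((⨅ i, p' i) - ⨅ i, q' i) ≤ B := by
  have hfirst : ∀ j, ⨅ i, p i ≤ (⨅ i, q i) + (B - (q' j - p' j)) := fun j =>
    iInf_le_iInf_add hp fun i => by linarith [h i j]
  have hsecond : ⨅ j, q' j ≤ (⨅ j, p' j) + (B - ((⨅ i, p i) - ⨅ i, q i)) :=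
    iInf_le_iInf_add hq' fun j => by linarith [hfirst j]
  linarith

/-- The exponent `γ r(x, h) + f(Y x)` of the one-step Bellman equation, where `Y x` is the random
successor of the state `x` and `r x h` the random reward under the control `h`. -/
def stepExponent {Ω X U : Type*} (Y : X → Ω → X) (r : X → U → Ω → ℝ) (γ : ℝ) (f : X → ℝ) (x : X)
    (h : U) : Ω → ℝ :=
  fun o => γ * r x h o + f (Y x o)

/-- The risk-sensitive Bellman operator, in its logarithmic form. -/
noncomputable def riskBellman {Ω X U : Type*} [MeasurableSpace Ω] (P : Measure Ω) (Y : X → Ω → X)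
    (r : X → U → Ω → ℝ) (γ : ℝ) (f : X → ℝ) (x : X) : ℝ :=
  ⨅ h, logLaplace P (stepExponent Y r γ f x h)

theorem isAdditiveEigenpair_riskBellman_zero {Ω X U : Type*} [MeasurableSpace Ω]
    [TopologicalSpace X] [Nonempty U] (P : Measure Ω) [IsProbabilityMeasure P] (Y : X → Ω → X)
    (r : X → U → Ω → ℝ) (ω : X → ℝ) :
    IsAdditiveEigenpair ω (riskBellman P Y r 0) 0 0 :=
  ⟨⟨0, continuous_zero, by simp⟩, fun x => by simp [riskBellman, logLaplace, stepExponent]⟩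

/-- The law of the successor of `x` after exponential tilting by the step exponent. -/
noncomputable def tiltedLaw {Ω X U : Type*} [MeasurableSpace Ω] [MeasurableSpace X] (P : Measure Ω)
    (Y : X → Ω → X) (r : X → U → Ω → ℝ) (γ : ℝ) (f : X → ℝ) (x : X) (h : U) : Measure X :=
  (P.tilted (stepExponent Y r γ f x h)).map (Y x)

/-- A Markov control model in which the control acts on the reward only. The weight `ω` satisfies a
drift condition and dominates the reward, up to noise with exponential moments; the transition laws
from each sublevel set of `ω` have a common nonzero component. -/
structure ControlledModel {Ω X U : Type*} [MeasurableSpace Ω] [TopologicalSpace X]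
    [MeasurableSpace X] [TopologicalSpace U] (P : Measure Ω) (Y : X → Ω → X)
    (r : X → U → Ω → ℝ) (ω : X → ℝ) (a₁ a₂ : Ω → ℝ) (b₁ b₂ : ℝ) : Prop where
  measurable_step : ∀ x, Measurable (Y x)
  measurable_reward : ∀ x h, Measurable (r x h)
  continuous_step : ∀ o, Continuous fun x => Y x o
  continuous_reward : ∀ o, Continuous fun p : X × U => r p.1 p.2 o
  continuous_weight : Continuous ω
  weight_nonneg : ∀ x, 0 ≤ ω x
  hasExpMoments_a₁ : HasExpMoments P a₁
  hasExpMoments_a₂ : HasExpMoments P a₂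
  b₁_mem : b₁ ∈ Ico (0 : ℝ) 1
  b₂_nonneg : 0 ≤ b₂
  step_growth : ∀ x o, ω (Y x o) ≤ a₁ o + b₁ * ω x
  reward_growth : ∀ x h o, |r x h o| ≤ a₂ o + b₂ * ω x
  minorization : ∀ R > 0, ∃ ν : Measure X, ν ≠ 0 ∧ IsFiniteMeasure ν ∧
    ∀ x, ω x ≤ R → ν ≤ P.map (Y x)

namespace ControlledModel

variable {Ω X U : Type*} [MeasurableSpace Ω] [TopologicalSpace X] [MeasurableSpace X]
  [TopologicalSpace U] {P : Measure Ω} {Y : X → Ω → X} {r : X → U → Ω → ℝ} {ω : X → ℝ}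
  {a₁ a₂ : Ω → ℝ} {b₁ b₂ : ℝ}

section Exponent

variable {Γ M γ : ℝ} {f g : X → ℝ}

theorem growthRate_nonneg (hY : ControlledModel P Y r ω a₁ a₂ b₁ b₂) (hΓ : 0 ≤ Γ) (hM : 0 ≤ M) :
    0 ≤ Γ * b₂ + M * b₁ :=
  add_nonneg (mul_nonneg hΓ hY.b₂_nonneg) (mul_nonneg hM hY.b₁_mem.1)

theorem abs_stepExponent_le (hY : ControlledModel P Y r ω a₁ a₂ b₁ b₂) (hγ : |γ| ≤ Γ)
    (hf : f ∈ weightedBall ω M) (x : X) (h : U) (o : Ω) :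
    |stepExponent Y r γ f x h o|
      ≤ Γ * a₂ o + M * a₁ o + ((Γ * b₂ + M * b₁) * ω x + M) := by
  have hreward : |γ * r x h o| ≤ Γ * (a₂ o + b₂ * ω x) := by
    rw [abs_mul]
    exact mul_le_mul hγ (hY.reward_growth x h o) (abs_nonneg _) ((abs_nonneg γ).trans hγ)
  have hstep := mul_le_mul_of_nonneg_left (hY.step_growth x o)
    (weightedBall.nonneg hf (hY.weight_nonneg x))
  exact (abs_add_le (γ * r x h o) (f (Y x o))).trans (by linarith [hf.2 (Y x o)])

theorem abs_stepExponent_sub_le (hY : ControlledModel P Y r ω a₁ a₂ b₁ b₂) {e : ℝ}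
    (hfg : ∀ x, |f x - g x| ≤ e * (1 + ω x)) (γ γ' : ℝ) (x : X) (h : U) (o : Ω) :
    |stepExponent Y r γ f x h o - stepExponent Y r γ' g x h o|
      ≤ |γ - γ'| * (a₂ o + b₂ * ω x) + e * (1 + ω (Y x o)) := by
  rw [stepExponent, stepExponent, add_sub_add_comm, ← sub_mul]
  refine (abs_add_le _ _).trans (add_le_add ?_ (hfg _))
  rw [abs_mul]
  exact mul_le_mul_of_nonneg_left (hY.reward_growth x h o) (abs_nonneg _)

theorem hasExpMoments_envelope (hY : ControlledModel P Y r ω a₁ a₂ b₁ b₂) (Γ M : ℝ) :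
    HasExpMoments P fun o => Γ * a₂ o + M * a₁ o :=
  (hY.hasExpMoments_a₂.const_mul Γ).add (hY.hasExpMoments_a₁.const_mul M)

variable [OpensMeasurableSpace X]

theorem hasExpMoments_stepExponent [IsFiniteMeasure P]
    (hY : ControlledModel P Y r ω a₁ a₂ b₁ b₂) (hf : f ∈ weightedBall ω M) (γ : ℝ) (x : X)
    (h : U) : HasExpMoments P (stepExponent Y r γ f x h) :=
  ((hY.hasExpMoments_envelope |γ| M).add (.const _)).of_abs_le
    (((hY.measurable_reward x h).const_mul γ).add
      (hf.1.measurable.comp (hY.measurable_step x))).aemeasurable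
    (hY.abs_stepExponent_le le_rfl hf x h)

theorem hasExpMoments_weight_step [IsFiniteMeasure P]
    (hY : ControlledModel P Y r ω a₁ a₂ b₁ b₂) (x : X) : HasExpMoments P fun o => ω (Y x o) :=
  (hY.hasExpMoments_a₁.add (.const _)).of_abs_le
    (hY.continuous_weight.measurable.comp (hY.measurable_step x)).aemeasurable fun o => by
      rw [abs_of_nonneg (hY.weight_nonneg _)]
      exact hY.step_growth x o

variable [IsProbabilityMeasure P]

theorem isProbabilityMeasure_tilted (hY : ControlledModel P Y r ω a₁ a₂ b₁ b₂)
    (hf : f ∈ weightedBall ω M) (γ : ℝ) (x : X) (h : U) :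
    IsProbabilityMeasure (P.tilted (stepExponent Y r γ f x h)) :=
  MeasureTheory.isProbabilityMeasure_tilted
    (hY.hasExpMoments_stepExponent hf γ x h).integrable_exp

theorem isProbabilityMeasure_tiltedLaw (hY : ControlledModel P Y r ω a₁ a₂ b₁ b₂)
    (hf : f ∈ weightedBall ω M) (γ : ℝ) (x : X) (h : U) :
    IsProbabilityMeasure (tiltedLaw P Y r γ f x h) :=
  have := hY.isProbabilityMeasure_tilted hf γ x h
  Measure.isProbabilityMeasure_map (hY.measurable_step x).aemeasurable

theorem integrable_weight_tiltedLaw (hY : ControlledModel P Y r ω a₁ a₂ b₁ b₂)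
    (hf : f ∈ weightedBall ω M) (γ : ℝ) (x : X) (h : U) :
    Integrable ω (tiltedLaw P Y r γ f x h) :=
  (integrable_map_measure hY.continuous_weight.measurable.aestronglyMeasurable
    (hY.measurable_step x).aemeasurable).2
    ((hY.hasExpMoments_weight_step x).tilted (hY.hasExpMoments_stepExponent hf γ x h)).integrable

end Exponent

theorem integral_tiltedLaw (hY : ControlledModel P Y r ω a₁ a₂ b₁ b₂) (γ : ℝ) (f : X → ℝ) (x : X)
    (h : U) {φ : X → ℝ} (hφ : Measurable φ) :
    ∫ z, φ z ∂(tiltedLaw P Y r γ f x h)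
      = ∫ o, φ (Y x o) ∂(P.tilted (stepExponent Y r γ f x h)) :=
  integral_map (hY.measurable_step x).aemeasurable hφ.aestronglyMeasurable

section TiltedLaw

variable [OpensMeasurableSpace X] [IsProbabilityMeasure P] {Γ M : ℝ}

/-- All exponential moments are needed here: the slope `2 C / δ` in the weight becomes small as
`δ`, the order of the moment, grows. -/
theorem exists_integral_tilted_le (hY : ControlledModel P Y r ω a₁ a₂ b₁ b₂) (hΓ : 0 ≤ Γ)
    (hM : 0 ≤ M) {a : Ω → ℝ} (ha : HasExpMoments P a) {η : ℝ} (hη : 0 < η) :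
    ∃ K, 0 ≤ K ∧ ∀ γ, |γ| ≤ Γ → ∀ f ∈ weightedBall ω M, ∀ x h,
      ∫ o, a o ∂(P.tilted (stepExponent Y r γ f x h)) ≤ K + η * ω x := by
  let A : Ω → ℝ := fun o => Γ * a₂ o + M * a₁ o
  let C := Γ * b₂ + M * b₁
  have hC : 0 ≤ C := hY.growthRate_nonneg hΓ hM
  obtain ⟨δ, hδ, hslope⟩ : ∃ δ : ℝ, 0 < δ ∧ 2 * C ≤ η * δ :=
    ⟨2 * C / η + 1, by positivity, by field_simp; linarith⟩
  let B := logLaplace P (fun o => A o + δ * a o) + logLaplace P A + 2 * M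
  refine ⟨|B| / δ, by positivity, fun γ hγ f hf x h => ?_⟩
  have hE := hY.hasExpMoments_stepExponent hf γ x h
  have hA := hY.hasExpMoments_envelope Γ M
  have habs := hY.abs_stepExponent_le hγ hf x h
  have hupper := logLaplace_le_add_const (hE.add (ha.const_mul δ)) (hA.add (ha.const_mul δ))
    (c := C * ω x + M) fun o => by linarith [le_of_abs_le (habs o)]
  have hlower := logLaplace_le_add_const hE.neg hA fun o => (neg_le_abs _).trans (habs o)
  have hmul : δ * ∫ o, a o ∂(P.tilted (stepExponent Y r γ f x h)) ≤ |B| + δ * (η * ω x) := by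
    linarith [mul_integral_tilted_le_logLaplace_sub ha hE δ, neg_logLaplace_le_logLaplace_neg hE,
      le_abs_self B, mul_le_mul_of_nonneg_right hslope (hY.weight_nonneg x)]
  rw [← mul_le_mul_iff_right₀ hδ, mul_add, mul_div_cancel₀ _ hδ.ne']
  exact hmul

theorem exists_drift (hY : ControlledModel P Y r ω a₁ a₂ b₁ b₂) (hΓ : 0 ≤ Γ) (hM : 0 ≤ M) :
    ∃ b ∈ Ico (0 : ℝ) 1, ∃ K, 0 ≤ K ∧ ∀ γ, |γ| ≤ Γ → ∀ f ∈ weightedBall ω M, ∀ x h,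
      ∫ z, ω z ∂(tiltedLaw P Y r γ f x h) ≤ K + b * ω x := by
  obtain ⟨hb0, hb1⟩ := hY.b₁_mem
  obtain ⟨K, hK, hnoise⟩ := hY.exists_integral_tilted_le hΓ hM hY.hasExpMoments_a₁
    (η := (1 - b₁) / 2) (by linarith)
  refine ⟨(1 + b₁) / 2, ⟨by linarith, by linarith⟩, K, hK, fun γ hγ f hf x h => ?_⟩
  have := hY.isProbabilityMeasure_tilted hf γ x h
  have hE := hY.hasExpMoments_stepExponent hf γ x h
  have hstep := integral_mono ((hY.hasExpMoments_weight_step x).tilted hE).integrable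
    ((hY.hasExpMoments_a₁.tilted hE).integrable.add (integrable_const (b₁ * ω x)))
    (hY.step_growth x)
  rw [integral_add' (hY.hasExpMoments_a₁.tilted hE).integrable (integrable_const _)] at hstep
  rw [hY.integral_tiltedLaw γ f x h hY.continuous_weight.measurable]
  simp only [integral_const, probReal_univ, one_smul] at hstep
  linarith [hnoise γ hγ f hf x h]

theorem sq_integral_le_of_le_map (hY : ControlledModel P Y r ω a₁ a₂ b₁ b₂) {γ : ℝ} {f : X → ℝ}
    (hγ : |γ| ≤ Γ) (hf : f ∈ weightedBall ω M) {x : X} {ν : Measure X}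
    (hν : ν ≤ P.map (Y x)) (h : U) {χ : X → ℝ} (hχ : Measurable χ) (h0 : ∀ z, 0 ≤ χ z)
    (h1 : ∀ z, χ z ≤ 1) :
    (∫ z, χ z ∂ν) ^ 2
      ≤ Real.exp (2 * (logLaplace P (fun o => Γ * a₂ o + M * a₁ o)
          + ((Γ * b₂ + M * b₁) * ω x + M))) * ∫ z, χ z ∂(tiltedLaw P Y r γ f x h) := by
  have hYx := (hY.measurable_step x).aemeasurable (μ := P)
  have := Measure.isProbabilityMeasure_map hYx
  have hE := hY.hasExpMoments_stepExponent hf γ x h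
  have hA := hY.hasExpMoments_envelope Γ M
  have habs := hY.abs_stepExponent_le hγ hf x h
  have hpos := logLaplace_le_add_const hE hA fun o => (le_abs_self _).trans (habs o)
  have hneg := logLaplace_le_add_const hE.neg hA fun o => (neg_le_abs _).trans (habs o)
  have hint : Integrable χ (P.map (Y x)) := .of_bound hχ.aestronglyMeasurable 1
    (.of_forall fun z => (Real.norm_of_nonneg (h0 z)).trans_le (h1 z))
  have hmono : ∫ z, χ z ∂ν ≤ ∫ o, χ (Y x o) ∂P := by
    rw [← integral_map hYx hχ.aestronglyMeasurable]
    exact integral_mono_measure hν (.of_forall h0) hint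
  rw [hY.integral_tiltedLaw γ f x h hχ]
  calc (∫ z, χ z ∂ν) ^ 2 ≤ (∫ o, χ (Y x o) ∂P) ^ 2 :=
        pow_le_pow_left₀ (integral_nonneg h0) hmono 2
    _ ≤ _ := sq_integral_le_mul_integral_tilted hE
        (hχ.comp (hY.measurable_step x)).aestronglyMeasurable (fun o => h0 _) fun o => h1 _
    _ ≤ _ := mul_le_mul_of_nonneg_right (Real.exp_le_exp.2 (by linarith))
        (integral_nonneg fun o => h0 _)

theorem exists_overlap (hY : ControlledModel P Y r ω a₁ a₂ b₁ b₂) (hΓ : 0 ≤ Γ) (hM : 0 ≤ M)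
    {R : ℝ} (hR : 0 < R) :
    ∃ η, 0 < η ∧ ∀ γ, |γ| ≤ Γ → ∀ f ∈ weightedBall ω M, ∀ g ∈ weightedBall ω M, ∀ x y h h',
      ω x ≤ R → ω y ≤ R → OverlapGE η (tiltedLaw P Y r γ f x h) (tiltedLaw P Y r γ g y h') := by
  obtain ⟨ν, hν0, _, hν⟩ := hY.minorization R hR
  have hmass : 0 < ν.real univ :=
    (measureReal_nonneg).lt_of_ne' (by simpa [measureReal_eq_zero_iff] using hν0)
  let Q := Real.exp (2 * (logLaplace P (fun o => Γ * a₂ o + M * a₁ o)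
    + ((Γ * b₂ + M * b₁) * R + M)))
  have hbound : ∀ γ, |γ| ≤ Γ → ∀ f ∈ weightedBall ω M, ∀ x h, ω x ≤ R → ∀ χ : X → ℝ,
      Measurable χ → (∀ z, 0 ≤ χ z) → (∀ z, χ z ≤ 1) →
      (∫ z, χ z ∂ν) ^ 2 ≤ Q * ∫ z, χ z ∂(tiltedLaw P Y r γ f x h) :=
    fun γ hγ f hf x h hx χ hχ h0 h1 =>
      (hY.sq_integral_le_of_le_map hγ hf (hν x hx) h hχ h0 h1).trans <|
        mul_le_mul_of_nonneg_right (Real.exp_le_exp.2 (by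
          linarith [mul_le_mul_of_nonneg_left hx (hY.growthRate_nonneg hΓ hM)]))
          (integral_nonneg h0)
  exact ⟨ν.real univ ^ 2 / (2 * Q), by positivity, fun γ hγ f hf g hg x y h h' hx hy =>
    .of_sq_integral_le (Real.exp_pos _) (hbound γ hγ f hf x h hx) (hbound γ hγ g hg y h' hy)⟩

end TiltedLaw

section Bellman

variable [OpensMeasurableSpace X] [IsProbabilityMeasure P] {Γ M γ : ℝ} {f g : X → ℝ}

theorem logLaplace_stepExponent_sub_le (hY : ControlledModel P Y r ω a₁ a₂ b₁ b₂)
    (hf : f ∈ weightedBall ω M) (hg : g ∈ weightedBall ω M) (γ : ℝ) (x : X) (h : U) :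
    logLaplace P (stepExponent Y r γ f x h) - logLaplace P (stepExponent Y r γ g x h)
      ≤ ∫ z, (f - g) z ∂(tiltedLaw P Y r γ f x h) := by
  rw [hY.integral_tiltedLaw γ f x h (hf.1.sub hg.1).measurable]
  simpa only [stepExponent, add_sub_add_left_eq_sub, Pi.sub_apply] using
    logLaplace_sub_le_integral_tilted (hY.hasExpMoments_stepExponent hf γ x h)
      (hY.hasExpMoments_stepExponent hg γ x h)

theorem logLaplace_stepExponent_sub_le_of_abs_sub_le (hY : ControlledModel P Y r ω a₁ a₂ b₁ b₂)
    (hf : f ∈ weightedBall ω M) (hg : g ∈ weightedBall ω M) {e : ℝ}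
    (hfg : ∀ x, |f x - g x| ≤ e * (1 + ω x)) (γ γ' : ℝ) (x : X) (h : U) :
    logLaplace P (stepExponent Y r γ f x h) - logLaplace P (stepExponent Y r γ' g x h)
      ≤ |γ - γ'| * (∫ o, a₂ o ∂(P.tilted (stepExponent Y r γ f x h)) + b₂ * ω x)
        + e * (1 + ∫ z, ω z ∂(tiltedLaw P Y r γ f x h)) := by
  have := hY.isProbabilityMeasure_tilted hf γ x h
  have hE := hY.hasExpMoments_stepExponent hf γ x h
  have hE' := hY.hasExpMoments_stepExponent hg γ' x h
  have ha₂ := (hY.hasExpMoments_a₂.tilted hE).integrable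
  have hω := ((hY.hasExpMoments_weight_step x).tilted hE).integrable
  have hreward := (ha₂.add (integrable_const (b₂ * ω x))).const_mul |γ - γ'|
  have hstep := ((integrable_const (1 : ℝ)).add hω).const_mul e
  have hmono := integral_mono ((hE.sub hE').tilted hE).integrable (hreward.add hstep) fun o =>
    (le_abs_self _).trans (hY.abs_stepExponent_sub_le hfg γ γ' x h o)
  rw [integral_add' hreward hstep, integral_const_mul, integral_const_mul,
    integral_add' ha₂ (integrable_const _), integral_add' (integrable_const _) hω] at hmono
  simp only [integral_const, probReal_univ, one_smul] at hmono
  rw [hY.integral_tiltedLaw γ f x h hY.continuous_weight.measurable]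
  exact (logLaplace_sub_le_integral_tilted hE hE').trans hmono

theorem bddBelow_logLaplace_stepExponent (hY : ControlledModel P Y r ω a₁ a₂ b₁ b₂)
    (hf : f ∈ weightedBall ω M) (γ : ℝ) (x : X) :
    BddBelow (range fun h => logLaplace P (stepExponent Y r γ f x h)) :=
  ⟨_, forall_mem_range.2 fun h => by
    have hE := hY.hasExpMoments_stepExponent hf γ x h
    exact (neg_le_neg (logLaplace_le_add_const hE.neg (hY.hasExpMoments_envelope |γ| M) fun o =>
      (neg_le_abs _).trans (hY.abs_stepExponent_le le_rfl hf x h o))).trans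
      (neg_le.1 (neg_logLaplace_le_logLaplace_neg hE))⟩

theorem continuous_logLaplace_stepExponent [FirstCountableTopology X] [FirstCountableTopology U]
    (hY : ControlledModel P Y r ω a₁ a₂ b₁ b₂) (hf : f ∈ weightedBall ω M) (γ : ℝ) :
    Continuous fun q : X × U => logLaplace P (stepExponent Y r γ f q.1 q.2) := by
  suffices hint : Continuous fun q : X × U =>
      ∫ o, Real.exp (stepExponent Y r γ f q.1 q.2 o) ∂P from
    hint.log fun q =>
      (integral_exp_pos (hY.hasExpMoments_stepExponent hf γ q.1 q.2).integrable_exp).ne'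
  refine continuous_iff_continuousAt.2 fun q₀ => ?_
  have hC := hY.growthRate_nonneg (abs_nonneg γ) (weightedBall.nonneg hf (hY.weight_nonneg q₀.1))
  refine continuousAt_of_dominated (bound := fun o =>
    Real.exp (|γ| * a₂ o + M * a₁ o + ((|γ| * b₂ + M * b₁) * (ω q₀.1 + 1) + M)))
    (.of_forall fun q =>
      (hY.hasExpMoments_stepExponent hf γ q.1 q.2).integrable_exp.aestronglyMeasurable) ?_
    ((hY.hasExpMoments_envelope |γ| M).add (.const _)).integrable_exp
    (.of_forall fun o => (Real.continuous_exp.comp (((hY.continuous_reward o).const_mul γ).add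
      (hf.1.comp ((hY.continuous_step o).comp continuous_fst)))).continuousAt)
  have hnear : ∀ᶠ q : X × U in nhds q₀, ω q.1 < ω q₀.1 + 1 :=
    (hY.continuous_weight.comp continuous_fst).continuousAt.eventually_lt continuousAt_const
      (lt_add_one _)
  filter_upwards [hnear] with q hq
  refine .of_forall fun o => ?_
  rw [Real.norm_eq_abs, Real.abs_exp, Real.exp_le_exp]
  linarith [le_of_abs_le (hY.abs_stepExponent_le (le_refl |γ|) hf q.1 q.2 o),
    mul_le_mul_of_nonneg_left hq.le hC]

theorem continuous_riskBellman [FirstCountableTopology X] [FirstCountableTopology U]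
    [CompactSpace U] (hY : ControlledModel P Y r ω a₁ a₂ b₁ b₂) (hf : f ∈ weightedBall ω M)
    (γ : ℝ) : Continuous (riskBellman P Y r γ f) := by
  have hinf := isCompact_univ.continuous_sInf (K := (univ : Set U))
    (f := fun x h => logLaplace P (stepExponent Y r γ f x h))
    (hY.continuous_logLaplace_stepExponent hf γ)
  simp only [image_univ] at hinf
  exact hinf

variable [Nonempty U]

theorem exists_contraction (hY : ControlledModel P Y r ω a₁ a₂ b₁ b₂) (hΓ : 0 ≤ Γ) (hM : 0 ≤ M) :
    ∃ β ∈ Ioc (0 : ℝ) 1, ∃ α ∈ Ico (0 : ℝ) 1, ∀ γ, |γ| ≤ Γ →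
      ∀ f ∈ weightedBall ω M, ∀ g ∈ weightedBall ω M, ∀ D, 0 ≤ D →
        SpanLE (fun x => 1 + β * ω x) D (f - g) →
          SpanLE (fun x => 1 + β * ω x) (α * D)
            (riskBellman P Y r γ f - riskBellman P Y r γ g) := by
  obtain ⟨b, ⟨hb0, hb1⟩, K, hK, hdrift⟩ := hY.exists_drift hΓ hM
  have hb : 0 < 1 - b := sub_pos.2 hb1
  obtain ⟨R, hR0, hR⟩ : ∃ R : ℝ, 0 < R ∧ 4 * K ≤ (1 - b) * R :=
    ⟨4 * K / (1 - b) + 1, by positivity, by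
      rw [mul_add, mul_div_cancel₀ _ hb.ne']; linarith⟩
  obtain ⟨η, hη, hoverlap⟩ := hY.exists_overlap hΓ hM hR0
  obtain ⟨β, hβ, α, hα, hcontr⟩ :=
    exists_contraction_of_drift_of_overlap hY.weight_nonneg hb0 hb1 hK hη hR0 hR
  refine ⟨β, hβ, α, hα, fun γ hγ f hf g hg D hD hspan x y => ?_⟩
  refine iInf_sub_iInf_sub_le (hY.bddBelow_logLaplace_stepExponent hf γ x)
    (hY.bddBelow_logLaplace_stepExponent hg γ y) fun h h' => ?_
  have := hY.isProbabilityMeasure_tiltedLaw hf γ x h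
  have := hY.isProbabilityMeasure_tiltedLaw hg γ y h'
  have hswap := hY.logLaplace_stepExponent_sub_le hg hf γ y h'
  rw [← neg_sub f g] at hswap
  simp only [Pi.neg_apply, integral_neg] at hswap
  linarith [hY.logLaplace_stepExponent_sub_le hf hg γ x h,
    hcontr _ _ x y (hY.integrable_weight_tiltedLaw hf γ x h)
      (hY.integrable_weight_tiltedLaw hg γ y h') (hdrift γ hγ f hf x h) (hdrift γ hγ g hg y h')
      (hoverlap γ hγ f hf g hg x y h h') (f - g) D (hf.1.sub hg.1).measurable hD hspan]

theorem exists_riskBellman_le (hY : ControlledModel P Y r ω a₁ a₂ b₁ b₂) (hΓ : 0 ≤ Γ)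
    (hM : 0 ≤ M) :
    ∃ K, 0 < K ∧ ∀ γ, |γ| ≤ Γ → ∀ γ', ∀ f ∈ weightedBall ω M, ∀ g ∈ weightedBall ω M, ∀ e,
      0 ≤ e → (∀ x, |f x - g x| ≤ e * (1 + ω x)) → ∀ x,
        riskBellman P Y r γ f x ≤ riskBellman P Y r γ' g x + K * (|γ - γ'| + e) * (1 + ω x) := by
  obtain ⟨b, ⟨_, hb1⟩, K₁, hK₁, hdrift⟩ := hY.exists_drift hΓ hM
  obtain ⟨K₂, hK₂, hnoise⟩ := hY.exists_integral_tilted_le hΓ hM hY.hasExpMoments_a₂ zero_lt_one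
  have hb₂ := hY.b₂_nonneg
  refine ⟨K₁ + K₂ + b₂ + 1, by positivity, fun γ hγ γ' f hf g hg e he hfg x => ?_⟩
  refine iInf_le_iInf_add (hY.bddBelow_logLaplace_stepExponent hf γ x) fun h => ?_
  have hωx := hY.weight_nonneg x
  have hbω := mul_le_of_le_one_left hωx hb1.le
  have hreward : ∫ o, a₂ o ∂(P.tilted (stepExponent Y r γ f x h)) + b₂ * ω x
      ≤ (K₁ + K₂ + b₂ + 1) * (1 + ω x) := by
    linarith [hnoise γ hγ f hf x h, mul_nonneg hK₁ hωx, mul_nonneg hK₂ hωx]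
  have hstep : 1 + ∫ z, ω z ∂(tiltedLaw P Y r γ f x h) ≤ (K₁ + K₂ + b₂ + 1) * (1 + ω x) := by
    linarith [hdrift γ hγ f hf x h, mul_nonneg hK₁ hωx, mul_nonneg hK₂ hωx, mul_nonneg hb₂ hωx]
  linarith [hY.logLaplace_stepExponent_sub_le_of_abs_sub_le hf hg hfg γ γ' x h,
    mul_le_mul_of_nonneg_left hreward (abs_nonneg (γ - γ')), mul_le_mul_of_nonneg_left hstep he]

theorem riskBellman_add_const (hY : ControlledModel P Y r ω a₁ a₂ b₁ b₂)
    (hf : f ∈ weightedBall ω M) (γ c : ℝ) (x : X) :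
    riskBellman P Y r γ (fun z => f z + c) x = riskBellman P Y r γ f x + c := by
  have hvalue : ∀ h, logLaplace P (stepExponent Y r γ (fun z => f z + c) x h)
      = logLaplace P (stepExponent Y r γ f x h) + c := fun h => by
    rw [← logLaplace_add_const (hY.hasExpMoments_stepExponent hf γ x h)]
    exact congrArg (logLaplace P) (funext fun o => (add_assoc _ _ _).symm)
  rw [riskBellman, iInf_congr hvalue]
  exact (ciInf_add (hY.bddBelow_logLaplace_stepExponent hf γ x) c).symm

theorem isLocalSpanContraction [FirstCountableTopology X] [FirstCountableTopology U]
    [CompactSpace U] (hY : ControlledModel P Y r ω a₁ a₂ b₁ b₂) :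
    IsLocalSpanContraction ω (riskBellman P Y r) := by
  have hnear : ∀ γ₀ : ℝ, ∀ᶠ γ in nhds γ₀, |γ| ≤ |γ₀| + 1 := fun γ₀ =>
    (continuous_abs.tendsto γ₀).eventually_le_const (lt_add_one _)
  have hmax (M : ℝ) : weightedBall ω M ⊆ weightedBall ω (max M 0) :=
    weightedBall.mono hY.weight_nonneg (le_max_left M 0)
  refine ⟨fun γ M f hf => hY.continuous_riskBellman hf γ,
    fun γ M f hf c x => hY.riskBellman_add_const hf γ c x, fun γ₀ M => ?_, fun γ₀ M => ?_⟩
  · obtain ⟨β, hβ, α, hα, hcontr⟩ :=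
      hY.exists_contraction (Γ := |γ₀| + 1) (by positivity) (le_max_right M 0)
    refine ⟨β, hβ, α, hα, ?_⟩
    filter_upwards [hnear γ₀] with γ hγ f hf g hg
    exact hcontr γ hγ f (hmax M hf) g (hmax M hg)
  · obtain ⟨K, hK, hle⟩ :=
      hY.exists_riskBellman_le (Γ := |γ₀| + 1) (by positivity) (le_max_right M 0)
    refine ⟨K, hK, ?_⟩
    filter_upwards [hnear γ₀] with γ hγ f hf g hg e he hfg x
    have hupper := hle γ hγ γ₀ f (hmax M hf) g (hmax M hg) e he hfg x
    have hlower := hle γ₀ (by linarith) γ g (hmax M hg) f (hmax M hf) e he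
      (fun z => (abs_sub_comm (g z) (f z)).trans_le (hfg z)) x
    rw [abs_sub_comm γ₀ γ] at hlower
    rw [Real.dist_eq]
    exact abs_sub_le_iff.2 ⟨by linarith, by linarith⟩

end Bellman

end ControlledModel

theorem mainTheorem5_general {Ω X U : Type*} [MeasurableSpace Ω] [TopologicalSpace X]
    [FirstCountableTopology X] [MeasurableSpace X] [OpensMeasurableSpace X] [Nonempty X]
    [TopologicalSpace U] [FirstCountableTopology U] [CompactSpace U] [Nonempty U]
    {P : Measure Ω} [IsProbabilityMeasure P] {Y : X → Ω → X} {r : X → U → Ω → ℝ} {ω : X → ℝ}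
    {a₁ a₂ : Ω → ℝ} {b₁ b₂ : ℝ} (hY : ControlledModel P Y r ω a₁ a₂ b₁ b₂) :
    (∃ γ₀ > 0, ∀ γ : ℝ, |γ| < γ₀ → γ ≠ 0 → ∃ u l,
      IsAdditiveEigenpair ω (riskBellman P Y r γ) u (l * γ) ∧
      ∀ u' l', IsAdditiveEigenpair ω (riskBellman P Y r γ) u' (l' * γ) →
        l' = l ∧ ∃ c, ∀ x, u' x = u x + c) ∧
    ∀ S : Set ℝ, 0 ∉ S → ∀ (u : ℝ → X → ℝ) (l : ℝ → ℝ),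
      (∀ γ ∈ S, IsAdditiveEigenpair ω (riskBellman P Y r γ) (u γ) (l γ * γ)) →
        ContinuousOn l S ∧ ∀ a x, ContinuousOn (fun γ => u γ x - u γ a) S := by
  have hT := hY.isLocalSpanContraction
  refine ⟨?_, fun S hS u l hu => ?_⟩
  · obtain ⟨a⟩ := ‹Nonempty X›
    obtain ⟨γ₀, hγ₀, hball⟩ := Metric.eventually_nhds_iff.1 <|
      hT.eventually_exists_eigenpair_near hY.weight_nonneg hY.continuous_weight
        (isAdditiveEigenpair_riskBellman_zero P Y r ω) a one_pos
    refine ⟨γ₀, hγ₀, fun γ hγ hγ0 => ?_⟩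
    obtain ⟨u, κ, hu, -⟩ := hball (by simpa only [Real.dist_eq, sub_zero] using hγ)
    have hκ : κ / γ * γ = κ := div_mul_cancel₀ κ hγ0
    refine ⟨u, κ / γ, by rwa [hκ], fun u' l' hu' => ?_⟩
    obtain ⟨hl, hc⟩ := hT.eigenpair_unique hY.weight_nonneg hu hu'
    exact ⟨eq_div_of_mul_eq hγ0 hl, hc⟩
  · obtain ⟨hκ, hu⟩ := hT.continuousOn_eigenpair hY.weight_nonneg hY.continuous_weight hu
    have hne : ∀ γ ∈ S, γ ≠ 0 := fun γ hγ => ne_of_mem_of_not_mem hγ hS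
    exact ⟨(hκ.div continuousOn_id hne).congr fun γ hγ =>
      (mul_div_cancel_right₀ (l γ) (hne γ hγ)).symm, hu⟩

theorem hasExpMoments_of_entropicUtility {Ω : Type*} [MeasurableSpace Ω] {P : Measure Ω}
    [IsFiniteMeasure P] {a : Ω → ℝ} (hm : AEMeasurable a P)
    (h : ∀ γ : ℝ, ∃ r : ℝ, entropicUtility P γ a = (r : EReal)) : HasExpMoments P a := by
  intro t
  rcases eq_or_ne t 0 with rfl | ht
  · simp
  obtain ⟨r, hr⟩ := h t
  rw [entropicUtility, if_neg ht] at hr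
  refine ⟨(hm.const_mul t).exp.aestronglyMeasurable, ?_⟩
  rw [hasFiniteIntegral_iff_ofReal (.of_forall fun o => (Real.exp_pos _).le)]
  refine lt_top_iff_ne_top.2 fun htop => ?_
  rw [htop, ENNReal.log_top] at hr
  rcases (inv_ne_zero ht).lt_or_gt with hneg | hpos
  · exact EReal.bot_ne_coe r ((EReal.coe_mul_top_of_neg hneg).symm.trans hr)
  · exact EReal.top_ne_coe r ((EReal.coe_mul_top_of_pos hpos).symm.trans hr)

theorem smul_le_map_of_real_le {Ω X : Type*} [MeasurableSpace Ω] [MeasurableSpace X]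
    {P : Measure Ω} [IsFiniteMeasure P] {ν : Measure X} [IsFiniteMeasure ν] {Y : Ω → X}
    (hY : Measurable Y) {c : ℝ} (hc : 0 ≤ c)
    (h : ∀ A, MeasurableSet A → c * ν.real A ≤ P.real (Y ⁻¹' A)) :
    ENNReal.ofReal c • ν ≤ P.map Y :=
  Measure.le_iff.2 fun A hA => by
    rw [Measure.map_apply hY hA, Measure.smul_apply, smul_eq_mul, ← ofReal_measureReal (μ := ν),
      ← ENNReal.ofReal_mul hc, ← ofReal_measureReal (μ := P)]
    exact ENNReal.ofReal_le_ofReal (h A hA)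

section Market

variable {Ω : Type*} [MeasurableSpace Ω] {P : Measure Ω} {k m : ℕ} {W : ℕ → Ω → Vec (k + m)}
  {U : Set (Vec m)} {G : Vec k → Vec (k + m) → Vec k} {F : Vec k → U → Vec (k + m) → ℝ}
  {ω : Vec k → ℝ}

theorem MarketAssumptions.controlledModel [IsFiniteMeasure P] {a₁ a₂ : Vec (k + m) → ℝ}
    {b₁ b₂ : ℝ} (hA : MarketAssumptions P W U G F ω a₁ a₂ b₁ b₂) :
    ControlledModel P (fun x o => G x (W 0 o)) (fun x h o => F x h (W 0 o)) ω
      (fun o => a₁ (W 0 o)) (fun o => a₂ (W 0 o)) b₁ b₂ := by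
  have hW := hA.measurable_noise 0
  have hstep (x : Vec k) : Measurable fun o => G x (W 0 o) :=
    hA.measurable_factor.comp (measurable_const.prodMk hW)
  exact
    { measurable_step := hstep
      measurable_reward x h :=
        hA.measurable_return.comp (measurable_const.prodMk (measurable_const.prodMk hW))
      continuous_step o := hA.continuous_factor (W 0 o)
      continuous_reward o := hA.continuous_return (W 0 o)
      continuous_weight := hA.continuous_weight
      weight_nonneg := hA.weight_nonneg
      hasExpMoments_a₁ :=
        hasExpMoments_of_entropicUtility (hA.measurable_a₁.comp hW).aemeasurable hA.entropic_a₁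
      hasExpMoments_a₂ :=
        hasExpMoments_of_entropicUtility (hA.measurable_a₂.comp hW).aemeasurable hA.entropic_a₂
      b₁_mem := Ioo_subset_Ico_self hA.b₁_mem
      b₂_nonneg := hA.b₂_pos.le
      step_growth x o := hA.factor_growth x (W 0 o)
      reward_growth x h o := hA.return_growth x h (W 0 o)
      minorization R hR := by
        obtain ⟨c, hc, ν, hν, hmin⟩ := hA.minorization R hR
        have hne : ENNReal.ofReal c • ν ≠ 0 := by simp [hc.not_ge, IsProbabilityMeasure.ne_zero ν]
        exact ⟨ENNReal.ofReal c • ν, hne, ν.smul_finite ENNReal.ofReal_ne_top, fun x hx =>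
          smul_le_map_of_real_le (hstep x) hc.le (hmin x hx)⟩ }

theorem mem_weightedSpace_iff (hω : ∀ x, 0 ≤ ω x) {f : Vec k → ℝ} :
    f ∈ weightedSpace ω ↔ ∃ M, f ∈ weightedBall ω M := by
  have hpos (x : Vec k) : 0 < 1 + ω x := by linarith [hω x]
  simp only [weightedSpace, weightedBall, BddAbove, Set.Nonempty, upperBounds, forall_mem_range,
    mem_ofPred_eq, div_le_iff₀ (hpos _), exists_and_left]

theorem isBellmanSolution_iff (hω : ∀ x, 0 ≤ ω x) {γ l : ℝ} {u : Vec k → ℝ} :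
    IsBellmanSolution P W U G F ω γ u l ↔ IsAdditiveEigenpair ω
      (riskBellman P (fun x o => G x (W 0 o)) (fun x h o => F x h (W 0 o)) γ) u (l * γ) :=
  ⟨fun hu => ⟨(mem_weightedSpace_iff hω).1 hu.1, fun x => (hu.2 x).symm⟩,
    fun hu => ⟨(mem_weightedSpace_iff hω).2 hu.1, fun x => (hu.2 x).symm⟩⟩

end Market

theorem mainTheorem5 {Ω : Type*} [MeasurableSpace Ω] (P : Measure Ω) [IsProbabilityMeasure P]
    {k m : ℕ} (W : ℕ → Ω → Vec (k + m)) (U : Set (Vec m))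
    (G : Vec k → Vec (k + m) → Vec k) (F : Vec k → U → Vec (k + m) → ℝ)
    (ω : Vec k → ℝ) (a₁ a₂ : Vec (k + m) → ℝ) (b₁ b₂ : ℝ)
    (hA : MarketAssumptions P W U G F ω a₁ a₂ b₁ b₂) :
    (∃ γ₀ : ℝ, γ₀ < 0 ∧ ∀ γ ∈ Ioo γ₀ 0, ∃ (u : Vec k → ℝ) (l : ℝ),
      IsBellmanSolution P W U G F ω γ u l ∧
      ∀ (u' : Vec k → ℝ) (l' : ℝ), IsBellmanSolution P W U G F ω γ u' l' →
        l' = l ∧ ∃ c : ℝ, ∀ x, u' x = u x + c) ∧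
    (∀ γ₀ : ℝ, γ₀ < 0 → ∀ (u : ℝ → Vec k → ℝ) (l : ℝ → ℝ),
      (∀ γ ∈ Ioo γ₀ 0, IsBellmanSolution P W U G F ω γ (u γ) (l γ)) →
        ContinuousOn l (Ioo γ₀ 0) ∧
        ∀ a x : Vec k, ContinuousOn (fun γ => u γ x - u γ a) (Ioo γ₀ 0)) := by
  have : Nonempty U := hA.nonempty_controls.to_subtype
  have : CompactSpace U := isCompact_iff_compactSpace.1 hA.compact_controls
  simp only [isBellmanSolution_iff hA.weight_nonneg]
  obtain ⟨⟨γ₀, hγ₀, hexists⟩, hcont⟩ := mainTheorem5_general hA.controlledModel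
  exact ⟨⟨-γ₀, neg_lt_zero.2 hγ₀, fun γ hγ => hexists γ
    (abs_lt.2 ⟨hγ.1, hγ.2.trans hγ₀⟩) hγ.2.ne⟩, fun γ₀ _ => hcont (Ioo γ₀ 0) right_notMem_Ioo⟩
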